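/- Conventions. Let $0<a\le\infty$ and let $J_a=[-a,a]$ if $a<\infty$, $J_a=\mathbb R$ if $a=\infty$. A function $f:J_a\to\mathbb C$ is called *complex analytic in* $J_a$ if it is the restriction of a complex function that is analytic at every point of $J_a$; $\rho_0\in(0,\infty]$ denotes the distance from the origin to the nearest singularity of this extension, i.e. the supremum of the radii of the discs about $0$ to which $f$ extends analytically ($\rho_0=\infty$ if $f$ is entire). For $0<b<\infty$, the finite part $⨍_0^{b}h(x)\,dx$ is $\lim_{\varepsilon\to0^+}C_\varepsilon$, where $\int_\varepsilon^b h(x)\,dx=C_\varepsilon+D_\varepsilon$, $C_\varepsilon$ converges as $\varepsilon\to0^+$ and $D_\varepsilon$ is a finite linear combination of diverging terms $\varepsilon^{-p}(\ln\varepsilon)^n$ ($p\ge0$, $n\in\mathbb Z_{\ge0}$, $(p,n)\ne(0,0)$). For $-b<\omega<b$, $\mathrm{PV}\int_{-b}^{b}h(x)\,dx$ is the Cauchy principal value with symmetric excision $|x-\omega|<\varepsilon$ of the singularity $\omega$. For infinite limits, $⨍_0^\infty$, $\int_0^\infty$ and $\mathrm{PV}\int_{-\infty}^{\infty}$ mean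 $\lim_{b\to\infty}$ of $⨍_0^b$, $\int_0^b$ and $\mathrm{PV}\int_{-b}^b$. **Theorem 4.5.** Let $0<\nu<1$, $0<a\le\infty$, and let $f$ be complex analytic in $J_a$. If $a=\infty$, assume also that $\mathrm{PV}\int_{-\infty}^{\infty}\frac{\operatorname{sgn}(x)f(x)}{|x|^{\nu}(\omega-x)}\,dx$ exists for all real $\omega$ with $0<|\omega|<\rho_0$. Then, for every real $\omega$ with $0<|\omega|<\min(a,\rho_0)$, the following hold; in each formula all finite parts and integrals on the right exist (they do not depend on $\omega$), the series converges absolutely, and the principal value on the left exists. (1) $$\mathrm{PV}\!\int_{-a}^a\frac{\operatorname{sgn}(x)f(x)}{|x|^\nu(\omega-x)}\,dx=-\sum_{k=0}^\infty\omega^k\,⨍_0^a\frac{(-1)^kf(-x)+f(x)}{x^{k+\nu+1}}\,dx-\pi\cot\!\Big(\frac{\pi\nu}{2}\Big)\frac{f(\omega)}{|\omega|^\nu}.$$ (2) If $f$ is even, then $$\mathrm{PV}\!\int_{-a}^a\frac{\operatorname{sgn}(x)f(x)}{|x|^\nu(\omega-x)}\,dx=-2\sum_{k=0}^\infty\omega^{2k}\,⨍_0^a\frac{f(x)}{x^{2k+\nu+1}}\,dx-\pi\cot\!\Big(\frac{\pi\nu}{2}\Big)\frac{f(\omega)}{|\omega|^\nu}.$$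 (3) If $f(x)=x^mg(x)$ on $J_a$ with an integer $m\ge0$ and $g$ complex analytic in $J_a$, then $$\mathrm{PV}\!\int_{-a}^a\frac{\operatorname{sgn}(x)f(x)}{|x|^\nu(\omega-x)}\,dx=-\sum_{k=0}^{m-1}\omega^k\int_0^a\frac{(-1)^{k+m}g(-x)+g(x)}{x^{k-m+\nu+1}}\,dx-\sum_{k=0}^\infty\omega^{k+m}\,⨍_0^a\frac{(-1)^kg(-x)+g(x)}{x^{k+\nu+1}}\,dx-\pi\cot\!\Big(\frac{\pi\nu}{2}\Big)\frac{\omega^mg(\omega)}{|\omega|^\nu}.$$ (4) If, in (3), $g$ is moreover even, then $$\mathrm{PV}\!\int_{-a}^a\frac{\operatorname{sgn}(x)f(x)}{|x|^\nu(\omega-x)}\,dx=-2\sum_{k=0}^\infty\omega^{2k+m}\,⨍_0^a\frac{g(x)}{x^{2k+\nu+1}}\,dx-\pi\cot\!\Big(\frac{\pi\nu}{2}\Big)\frac{\omega^mg(\omega)}{|\omega|^\nu}-2\sum_{k=0}^{\lfloor(m-2)/2\rfloor}\omega^{2k+2\lfloor(m+1)/2\rfloor-m}\int_0^a\frac{g(x)\,dx}{x^{2k-2\lfloor(m-2)/2\rfloor+\nu-1}}.$$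 (Empty sums are $0$.) -/

import Mathlib

open Filter Set MeasureTheory
open scoped Topology ENNReal

noncomputable section

namespace FinitePartHilbert

/-- The symmetric interval `[-a, a]`; it is the whole real line when `a = ∞`. -/
def symmInterval (a : ℝ≥0∞) : Set ℝ := {x | ‖x‖ₑ ≤ a}

/-- `f` is complex analytic in `s`: it is the restriction to `s` of a function of a complex
variable that is analytic at every point of `s` (hence on an open neighbourhood of `s` in `ℂ`). -/
def ComplexAnalyticIn (f : ℝ → ℂ) (s : Set ℝ) : Prop :=
  ∃ F : ℂ → ℂ, AnalyticOnNhd ℂ F ((fun x : ℝ => (x : ℂ)) '' s) ∧ ∀ x ∈ s, F (x : ℂ) = f x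

/-- The distance `ρ₀` from the origin to the nearest singularity of the complex extension of `f`:
the supremum of the radii `r` of the open discs about `0` to which `f` extends analytically
(`∞` if the extension is entire). -/
def singularityDistance (f : ℝ → ℂ) : ℝ≥0∞ :=
  sSup {r : ℝ≥0∞ | ∃ F : ℂ → ℂ, AnalyticOnNhd ℂ F {z | ‖z‖ₑ < r} ∧
    ∀ᶠ x : ℝ in 𝓝 0, F (x : ℂ) = f x}

/-- Given `P b v`, read "the integral with limit of integration `b` has the value `v`", for real
`b`, this is the same notion for a limit of integration `a` that may be infinite. For `a = ∞` the
value is the limit, as `b → ∞`, of the values for real `b`. -/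
def WithLimit (P : ℝ → ℂ → Prop) (a : ℝ≥0∞) (v : ℂ) : Prop :=
  (a ≠ ∞ → P a.toReal v) ∧
  (a = ∞ → ∃ I : ℝ → ℂ, (∀ᶠ b in atTop, P b (I b)) ∧ Tendsto I atTop (𝓝 v))

/-- The Cauchy principal value over `[-b, b]`, `b` real, of a function `h` that is singular
at `ω`, exists and equals `v`. -/
def HasPVOn (h : ℝ → ℂ) (ω b : ℝ) (v : ℂ) : Prop :=
  (∀ ε : ℝ, 0 < ε → IntegrableOn h (Icc (-b) b \ Metric.ball ω ε)) ∧
  Tendsto (fun ε : ℝ => ∫ x in Icc (-b) b \ Metric.ball ω ε, h x) (𝓝[>] 0) (𝓝 v)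

/-- `PV ∫_{-a}^{a} h(x) dx = v`, `0 < a ≤ ∞`, with the singularity of `h` at `ω`. -/
def HasPV (h : ℝ → ℂ) (ω : ℝ) (a : ℝ≥0∞) (v : ℂ) : Prop :=
  WithLimit (HasPVOn h ω) a v

/-- The possible diverging parts: finite linear combinations of the functions
`ε ↦ ε ^ (-p) * (log ε) ^ n` that diverge as `ε → 0⁺`. -/
def divergingParts : Submodule ℂ (ℝ → ℂ) :=
  Submodule.span ℂ {D | ∃ (p : ℝ) (n : ℕ), 0 ≤ p ∧ (0 < p ∨ 0 < n) ∧
    D = fun ε : ℝ => ((ε ^ (-p) * Real.log ε ^ n : ℝ) : ℂ)}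

/-- The finite part of `∫_0^b h(x) dx`, `b` real, exists and equals `v`: one has
`∫_ε^b h(x) dx = C_ε + D_ε` with `D_ε` a diverging part and `C_ε → v` as `ε → 0⁺`. -/
def HasFinitePartOn (h : ℝ → ℂ) (b : ℝ) (v : ℂ) : Prop :=
  (∀ ε ∈ Ioo 0 b, IntervalIntegrable h volume ε b) ∧
  ∃ D ∈ divergingParts, Tendsto (fun ε : ℝ => (∫ x in ε..b, h x) - D ε) (𝓝[>] 0) (𝓝 v)

/-- The finite part of `∫_0^a h(x) dx`, `0 < a ≤ ∞`, exists and equals `v`. -/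
def HasFinitePart (h : ℝ → ℂ) (a : ℝ≥0∞) (v : ℂ) : Prop :=
  WithLimit (HasFinitePartOn h) a v

/-- The convergent integral `∫_0^a h(x) dx`, `0 < a ≤ ∞`, exists and equals `v`
(as an improper integral `lim_{b → ∞} ∫_0^b h(x) dx` when `a = ∞`). -/
def HasConvergentIntegral (h : ℝ → ℂ) (a : ℝ≥0∞) (v : ℂ) : Prop :=
  WithLimit (fun b v => IntervalIntegrable h volume 0 b ∧ ∫ x in (0 : ℝ)..b, h x = v) a v

/-- The integrand `sgn(x) f(x) / (|x|^ν (ω - x))`. -/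
def hilbertIntegrand (ν : ℝ) (f : ℝ → ℂ) (ω x : ℝ) : ℂ :=
  (Real.sign x : ℂ) * f x / (((|x| ^ ν : ℝ) : ℂ) * ((ω : ℂ) - (x : ℂ)))

end FinitePartHilbert

end

namespace FinitePartHilbert

/-! ### Algebra of principal values -/

/-! Expanding `1 / (ω - x)` in powers of `ω / x` under the integral sign is illegitimate near `0`.
Doing it anyway and reading each divergent integral as a finite part misses exactly one term, the
cotangent. The proof computes that term for `f = 1` and carries it over to general `f`.

For `f = 1` and `ω > 0`, subtract `ω ^ (-ν)` from `sgn(x) |x| ^ (-ν)`. What remains is integrable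
across `ω`, and the subtracted term has a logarithm as principal value. Folding `x` with `-x` leaves
`2 (x ^ (1 - ν) - ω ^ (1 - ν)) / (ω ^ 2 - x ^ 2)`, expanded geometrically on each side of `ω`. The
logarithms cancel, and the boundary terms at `ω` form the partial fraction series of `cot (π ν / 2)`
(`hasPVOn_const_pos`). The identity `x ^ (j + 1) / (ω - x) = ω x ^ j / (ω - x) - x ^ j` gives all
monomials by induction (`hasPVOn_monomial`), and an absolutely convergent double series gives all
power series on `[-R, R]` with `|ω| < R` (`HasExpansionOn.hasPVOn`).

The coefficient of `ω ^ k` found this way is the finite part over `[0, R]`. The Taylor terms of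
degree at most `k` are integrated by primitives without constant, and since `ν` is not an integer
neither logarithms nor constant terms arise. On `R < |x| ≤ b` the geometric series converges
uniformly, so both sides extend to `[-b, b]` (`HasExpansionOn.hasPVOn_extend`).

For `a = ∞`, the principal values at one pair `±ω` control the tails of the moments `k = 0, 1`.
Integration by parts against `x ^ (-2 i)` then controls all moments, with tails of size `R ^ (-k)`,
and dominated convergence exchanges `b → ∞` with the sum (`hasPV_top_of_moments`).

The special forms follow from the general one. If `f = x ^ m g`, the first `m` Taylor coefficients
vanish, so those finite parts are ordinary integrals. If `g` is even, every second moment vanishes.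
-/

lemma HasPVOn.add {h₁ h₂ : ℝ → ℂ} {ω b : ℝ} {v₁ v₂ : ℂ} (H₁ : HasPVOn h₁ ω b v₁)
    (H₂ : HasPVOn h₂ ω b v₂) : HasPVOn (fun x => h₁ x + h₂ x) ω b (v₁ + v₂) := by
  refine ⟨fun ε hε => (H₁.1 ε hε).add (H₂.1 ε hε), (H₁.2.add H₂.2).congr' ?_⟩
  filter_upwards [self_mem_nhdsWithin] with ε hε
  exact (integral_add (H₁.1 ε hε) (H₂.1 ε hε)).symm

lemma HasPVOn.const_mul {h : ℝ → ℂ} {ω b : ℝ} {v : ℂ} (H : HasPVOn h ω b v) (c : ℂ) :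
    HasPVOn (fun x => c * h x) ω b (c * v) := by
  refine ⟨fun ε hε => (H.1 ε hε).const_mul c, (H.2.const_mul c).congr' ?_⟩
  filter_upwards with ε
  exact (integral_const_mul c _).symm

lemma HasPVOn.unique {h : ℝ → ℂ} {ω b : ℝ} {v₁ v₂ : ℂ} (H₁ : HasPVOn h ω b v₁)
    (H₂ : HasPVOn h ω b v₂) : v₁ = v₂ :=
  tendsto_nhds_unique H₁.2 H₂.2

lemma HasPVOn.congr {h₁ h₂ : ℝ → ℂ} {ω b : ℝ} {v : ℂ} (H : HasPVOn h₁ ω b v)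
    (heq : ∀ x ∈ Icc (-b) b, x ≠ ω → h₁ x = h₂ x) : HasPVOn h₂ ω b v := by
  have key : ∀ ε : ℝ, 0 < ε → EqOn h₁ h₂ (Icc (-b) b \ Metric.ball ω ε) := by
    rintro ε hε x ⟨hx, hx'⟩
    refine heq x hx ?_
    rintro rfl
    exact hx' (Metric.mem_ball_self hε)
  have hm : ∀ ε : ℝ, MeasurableSet (Icc (-b) b \ Metric.ball ω ε) := fun ε =>
    measurableSet_Icc.diff measurableSet_ball
  refine ⟨fun ε hε => (H.1 ε hε).congr_fun (key ε hε) (hm ε), H.2.congr' ?_⟩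
  filter_upwards [self_mem_nhdsWithin] with ε hε
  exact setIntegral_congr_fun (hm ε) (key ε hε)

/-- By absolute continuity of the integral, the excised ball contributes nothing in the limit. -/
lemma hasPVOn_of_integrableOn {h : ℝ → ℂ} {ω b : ℝ} (hh : IntegrableOn h (Icc (-b) b)) :
    HasPVOn h ω b (∫ x in Icc (-b) b, h x) := by
  refine ⟨fun ε _ => hh.mono_set sdiff_subset, ?_⟩
  have h0 : Tendsto (fun ε : ℝ => ∫ x in Metric.ball ω ε, h x ∂(volume.restrict (Icc (-b) b)))
      (𝓝[>] 0) (𝓝 0) := by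
    refine Integrable.tendsto_setIntegral_nhds_zero hh ?_
    have hv : Tendsto (fun ε : ℝ => ENNReal.ofReal (2 * ε)) (𝓝[>] 0) (𝓝 0) := by
      have : Tendsto (fun ε : ℝ => ENNReal.ofReal (2 * ε)) (𝓝 0) (𝓝 (ENNReal.ofReal (2 * 0))) :=
        (ENNReal.continuous_ofReal.comp (continuous_const.mul continuous_id)).tendsto 0
      simpa using this.mono_left nhdsWithin_le_nhds
    refine tendsto_of_tendsto_of_tendsto_of_le_of_le tendsto_const_nhds hv (fun _ => zero_le)
      fun ε => ?_
    exact (Measure.restrict_apply_le _ _).trans (Real.volume_ball ω ε).le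
  have h1 := (tendsto_const_nhds (x := ∫ x in Icc (-b) b, h x)).sub h0
  rw [sub_zero] at h1
  refine h1.congr fun ε => ?_
  rw [Measure.restrict_restrict measurableSet_ball, inter_comm,
    ← integral_inter_add_sdiff (measurableSet_ball (x := ω) (ε := ε)) hh]
  ring

/-- Once `ε` is below the distance from `ω` to `±R`, the excised ball lies in `[-R, R]` and the
outer integral no longer depends on `ε`. -/
lemma HasPVOn.extend {h : ℝ → ℂ} {ω R b : ℝ} {v : ℂ} (H : HasPVOn h ω R v) (hω : |ω| < R)
    (hRb : R ≤ b) (hh : IntegrableOn h (Icc (-b) b \ Icc (-R) R)) :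
    HasPVOn h ω b (v + ∫ x in Icc (-b) b \ Icc (-R) R, h x) := by
  obtain ⟨h1, h2⟩ := abs_lt.1 hω
  have hs : ∀ ε : ℝ, Icc (-b) b \ Metric.ball ω ε ⊆
      (Icc (-R) R \ Metric.ball ω ε) ∪ (Icc (-b) b \ Icc (-R) R) := by
    rintro ε x ⟨hx, hx'⟩
    by_cases hxR : x ∈ Icc (-R) R
    · exact Or.inl ⟨hxR, hx'⟩
    · exact Or.inr ⟨hx, hxR⟩
  refine ⟨fun ε hε => ((H.1 ε hε).union hh).mono_set (hs ε), (H.2.add_const _).congr' ?_⟩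
  have hpos : 0 < min (R - ω) (R + ω) := lt_min (by linarith) (by linarith)
  filter_upwards [Ioo_mem_nhdsGT hpos] with ε hε
  have hε1 := hε.2.trans_le (min_le_left _ _)
  have hε2 := hε.2.trans_le (min_le_right _ _)
  rw [← setIntegral_union _ (measurableSet_Icc.diff measurableSet_Icc) (H.1 ε hε.1) hh]
  · congr 2
    refine (hs ε).antisymm' ?_
    rintro x (⟨hx, hx'⟩ | ⟨hx, hx'⟩)
    · exact ⟨⟨by linarith [hx.1], by linarith [hx.2]⟩, hx'⟩
    · refine ⟨hx, fun hb => hx' ?_⟩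
      rw [Metric.mem_ball, Real.dist_eq, abs_lt] at hb
      exact ⟨by linarith [hb.1], by linarith [hb.2]⟩
  · exact disjoint_left.2 fun x hx hx' => hx'.2 hx.1

lemma HasPVOn.comp_neg {h : ℝ → ℂ} {ω b : ℝ} {v : ℂ} (H : HasPVOn h ω b v) :
    HasPVOn (fun x => h (-x)) (-ω) b v := by
  have hs : ∀ ε : ℝ, (fun x : ℝ => -x) ⁻¹' (Icc (-b) b \ Metric.ball ω ε) =
      Icc (-b) b \ Metric.ball (-ω) ε := by
    intro ε
    ext x
    simp only [mem_preimage, Set.mem_sdiff, mem_Icc, Metric.mem_ball, Real.dist_eq]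
    rw [show -x - ω = -(x - -ω) by ring, abs_neg]
    constructor <;> rintro ⟨⟨h1, h2⟩, h3⟩ <;> exact ⟨⟨by linarith, by linarith⟩, h3⟩
  have hmp : MeasurePreserving (fun x : ℝ => -x) volume volume := Measure.measurePreserving_neg _
  have hme : MeasurableEmbedding (fun x : ℝ => -x) := (Homeomorph.neg ℝ).measurableEmbedding
  refine ⟨fun ε hε => ?_, H.2.congr fun ε => ?_⟩
  · rw [← hs]
    exact (hmp.integrableOn_comp_preimage hme).2 (H.1 ε hε)
  · rw [← hs]
    exact (hmp.setIntegral_preimage_emb hme _ _).symm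

/-- The excision is symmetric, so the two `log ε` contributions cancel and the excised integral is
constant for small `ε`. -/
lemma hasPVOn_one_div_sub {ω b : ℝ} (hω : |ω| < b) :
    HasPVOn (fun x => 1 / ((ω : ℂ) - (x : ℂ))) ω b
      ((Real.log ((b + ω) / (b - ω)) : ℝ) : ℂ) := by
  obtain ⟨h1, h2⟩ := abs_lt.1 hω
  have hcast : (fun x : ℝ => 1 / ((ω : ℂ) - (x : ℂ))) = fun x : ℝ => ((1 / (ω - x) : ℝ) : ℂ) := by
    ext x; push_cast; rfl
  rw [hcast]
  have hint : ∀ ε : ℝ, 0 < ε → IntegrableOn (fun x : ℝ => ((1 / (ω - x) : ℝ) : ℂ))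
      (Icc (-b) b \ Metric.ball ω ε) := by
    intro ε hε
    refine ContinuousOn.integrableOn_compact (isCompact_Icc.diff Metric.isOpen_ball) ?_
    refine Complex.continuous_ofReal.comp_continuousOn ?_
    refine continuousOn_const.div (continuousOn_const.sub continuousOn_id) ?_
    rintro x ⟨_, hx⟩ h0
    exact hx (by rw [← sub_eq_zero.1 h0]; exact Metric.mem_ball_self hε)
  refine ⟨hint, tendsto_const_nhds.congr' ?_⟩
  have hpos : 0 < min (b - ω) (b + ω) := lt_min (by linarith) (by linarith)
  filter_upwards [Ioo_mem_nhdsGT hpos] with ε hε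
  have hε0 : 0 < ε := hε.1
  have hε1 := hε.2.trans_le (min_le_left _ _)
  have hε2 := hε.2.trans_le (min_le_right _ _)
  have hs : Icc (-b) b \ Metric.ball ω ε = Icc (-b) (ω - ε) ∪ Icc (ω + ε) b := by
    ext x
    simp only [Set.mem_sdiff, mem_Icc, Metric.mem_ball, Real.dist_eq, mem_union, abs_lt, not_and_or,
      not_lt]
    constructor
    · rintro ⟨⟨h1, h2⟩, h3 | h3⟩
      · exact Or.inl ⟨h1, by linarith⟩
      · exact Or.inr ⟨by linarith, h2⟩
    · rintro (⟨h1, h2⟩ | ⟨h1, h2⟩)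
      · exact ⟨⟨h1, by linarith⟩, Or.inl (by linarith)⟩
      · exact ⟨⟨by linarith, h2⟩, Or.inr (by linarith)⟩
  have hI := hint ε hε0
  rw [hs] at hI ⊢
  rw [setIntegral_union (disjoint_left.2 fun x hx hx' => by linarith [hx.2, hx'.1])
    measurableSet_Icc hI.left_of_union hI.right_of_union, integral_Icc_eq_integral_Ioc,
    integral_Icc_eq_integral_Ioc, ← intervalIntegral.integral_of_le (by linarith),
    ← intervalIntegral.integral_of_le (by linarith), intervalIntegral.integral_ofReal,
    intervalIntegral.integral_ofReal,
    intervalIntegral.integral_comp_sub_left (fun x => 1 / x) ω,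
    intervalIntegral.integral_comp_sub_left (fun x => 1 / x) ω,
    integral_one_div_of_pos (by linarith) (by linarith),
    integral_one_div_of_neg (by linarith) (by linarith), ← Complex.ofReal_add,
    Real.log_div (by linarith) (by linarith), Real.log_div (by linarith) (by linarith),
    show ω - (ω + ε) = -ε by ring, show ω - b = -(b - ω) by ring, neg_div_neg_eq,
    Real.log_div hε0.ne' (by linarith)]
  congr 1
  rw [show ω - (ω - ε) = ε by ring, show ω - -b = b + ω by ring]
  ring

/-! ### The principal value for the constant function -/

lemma integrableOn_abs_rpow_neg {ν : ℝ} (hν : ν < 1) {b : ℝ} (hb : 0 ≤ b) :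
    IntegrableOn (fun x : ℝ => |x| ^ (-ν)) (Icc (-b) b) := by
  have h1 : IntervalIntegrable (fun x : ℝ => |x| ^ (-ν)) volume 0 b := by
    refine (intervalIntegral.intervalIntegrable_rpow' (a := 0) (b := b)
      (show -1 < -ν by linarith)).congr ?_
    intro x hx
    rw [uIoc_of_le hb] at hx
    simp only [abs_of_pos hx.1]
  have h2 := (IntervalIntegrable.iff_comp_neg (f := fun x : ℝ => |x| ^ (-ν)) (a := 0) (b := b)).1 h1
  simp only [abs_neg, neg_zero] at h2
  rw [integrableOn_Icc_iff_integrableOn_Ioc,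
    ← intervalIntegrable_iff_integrableOn_Ioc_of_le (by linarith)]
  exact h2.symm.trans h1

lemma abs_sign_le_one (x : ℝ) : |Real.sign x| ≤ 1 := by
  rcases Real.sign_apply_eq x with h | h | h <;> simp [h]

lemma measurable_sign : Measurable Real.sign := by
  unfold Real.sign
  exact Measurable.ite measurableSet_Iio measurable_const
    (Measurable.ite measurableSet_Ioi measurable_const measurable_const)

lemma integrableOn_sign_mul_div {ν : ℝ} (hν : ν < 1) {b : ℝ} (hb : 0 ≤ b) {g : ℝ → ℂ} {C : ℝ}
    (hg : AEStronglyMeasurable g (volume.restrict (Icc (-b) b)))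
    (hC : ∀ x ∈ Icc (-b) b, ‖g x‖ ≤ C) :
    IntegrableOn (fun x : ℝ => (Real.sign x : ℂ) * g x / ((|x| ^ ν : ℝ) : ℂ)) (Icc (-b) b) := by
  refine Integrable.mono' ((integrableOn_abs_rpow_neg hν hb).const_mul C) ?_ ?_
  · have h1 : AEStronglyMeasurable (fun x : ℝ => (Real.sign x : ℂ))
        (volume.restrict (Icc (-b) b)) :=
      (Complex.measurable_ofReal.comp measurable_sign).aestronglyMeasurable
    have h2 : Measurable (fun x : ℝ => ((|x| ^ ν : ℝ) : ℂ)) := by fun_prop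
    simp only [div_eq_mul_inv]
    exact (h1.mul hg).mul h2.inv.aestronglyMeasurable
  · filter_upwards [ae_restrict_mem measurableSet_Icc] with x hx
    rw [norm_div, norm_mul, Complex.norm_real, Complex.norm_real, Real.norm_eq_abs,
      Real.norm_of_nonneg (Real.rpow_nonneg (abs_nonneg x) ν), Real.rpow_neg (abs_nonneg x),
      div_eq_mul_inv]
    refine mul_le_mul_of_nonneg_right ?_ (inv_nonneg.2 (Real.rpow_nonneg (abs_nonneg x) ν))
    calc |Real.sign x| * ‖g x‖ ≤ 1 * ‖g x‖ :=
          mul_le_mul_of_nonneg_right (abs_sign_le_one x) (norm_nonneg _)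
      _ ≤ C := by rw [one_mul]; exact hC x hx

lemma setIntegral_Icc_neg_eq {E : Type*} [NormedAddCommGroup E] [NormedSpace ℝ E]
    {h : ℝ → E} {b : ℝ} (hb : 0 ≤ b)
    (hh : IntegrableOn h (Icc (-b) b)) :
    IntervalIntegrable (fun x => h x + h (-x)) volume 0 b ∧
      ∫ x in Icc (-b) b, h x = ∫ x in (0 : ℝ)..b, (h x + h (-x)) := by
  rw [integrableOn_Icc_iff_integrableOn_Ioc,
    ← intervalIntegrable_iff_integrableOn_Ioc_of_le (by linarith)] at hh
  have h1 : IntervalIntegrable h volume (-b) 0 :=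
    hh.mono_set (uIcc_subset_uIcc (left_mem_uIcc) (by rw [uIcc_of_le (by linarith)]; simp [hb]))
  have h2 : IntervalIntegrable h volume 0 b :=
    hh.mono_set (uIcc_subset_uIcc (by rw [uIcc_of_le (by linarith)]; simp [hb]) right_mem_uIcc)
  have h3 := ((IntervalIntegrable.iff_comp_neg (f := h) (a := -b) (b := 0)).1 h1).symm
  rw [neg_neg, neg_zero] at h3
  refine ⟨h2.add h3, ?_⟩
  rw [intervalIntegral.integral_add h2 h3, intervalIntegral.integral_comp_neg, neg_zero,
    integral_Icc_eq_integral_Ioc, ← intervalIntegral.integral_of_le (by linarith),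
    ← intervalIntegral.integral_add_adjacent_intervals h1 h2, add_comm]

/-- With terms of constant sign, summability of the integrals is already summability of the
integrals of the norms. This permits termwise integration up to the endpoint `ω`, where the
geometric ratio tends to `1`. -/
lemma hasSum_intervalIntegral_of_nonpos {a b : ℝ} (hab : a ≤ b) {F : ℕ → ℝ → ℝ} {p : ℝ → ℝ}
    (hF : ∀ n, IntervalIntegrable (F n) volume a b) (hneg : ∀ n, ∀ x ∈ Ioo a b, F n x ≤ 0)
    (hs : Summable fun n => ∫ x in a..b, F n x)
    (hp : ∀ x ∈ Ioo a b, HasSum (fun n => F n x) (p x)) :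
    HasSum (fun n => ∫ x in a..b, F n x) (∫ x in a..b, p x) := by
  simp only [intervalIntegral.integral_of_le hab, integral_Ioc_eq_integral_Ioo] at hs ⊢
  have h := hasSum_integral_of_summable_integral_norm (F := F)
    (μ := volume.restrict (Ioo a b)) (fun n => (hF n).1.mono_set Ioo_subset_Ioc_self) ?_
  · rwa [setIntegral_congr_fun measurableSet_Ioo fun x hx => (hp x hx).tsum_eq] at h
  · refine hs.neg.congr fun n => ?_
    rw [← integral_neg]
    refine setIntegral_congr_fun measurableSet_Ioo fun x hx => ?_
    simp [abs_of_nonpos (hneg n x hx)]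

/-! ### Partial fractions of the cotangent -/

lemma summable_one_div_sub_one_div {ν : ℝ} (hν : ν ∈ Ioo (0 : ℝ) 1) :
    Summable (fun n : ℕ => 1 / (2 * (n : ℝ) + 2 - ν) - 1 / (2 * (n : ℝ) + 1)) ∧
    Summable (fun n : ℕ => 1 / (2 * (n : ℝ) + 1) - 1 / (2 * (n : ℝ) + ν)) := by
  obtain ⟨h0, h1⟩ := hν
  have hsum : Summable fun n : ℕ => 1 / ((n : ℝ) + 1) ^ 2 := by
    have := (summable_nat_add_iff 1).2 (Real.summable_one_div_nat_pow.2 one_lt_two)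
    exact_mod_cast this
  constructor
  · refine Summable.of_norm_bounded hsum fun n => ?_
    have hn : (0 : ℝ) ≤ n := n.cast_nonneg
    have e : 1 / (2 * (n : ℝ) + 2 - ν) - 1 / (2 * (n : ℝ) + 1) =
        -((1 - ν) / ((2 * (n : ℝ) + 2 - ν) * (2 * (n : ℝ) + 1))) := by
      rw [div_sub_div _ _ (by linarith) (by linarith), ← neg_div]
      congr 1
      ring
    rw [e, norm_neg, Real.norm_of_nonneg (div_nonneg (by linarith)
      (mul_nonneg (by linarith) (by linarith)))]
    gcongr
    · linarith
    · nlinarith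
  · refine Summable.of_norm_bounded (hsum.mul_left (1 / ν)) fun n => ?_
    have hn : (0 : ℝ) ≤ n := n.cast_nonneg
    have e : 1 / (2 * (n : ℝ) + 1) - 1 / (2 * (n : ℝ) + ν) =
        -((1 - ν) / ((2 * (n : ℝ) + 1) * (2 * (n : ℝ) + ν))) := by
      rw [div_sub_div _ _ (by linarith) (by linarith), ← neg_div]
      congr 1
      ring
    rw [e, norm_neg, Real.norm_of_nonneg (div_nonneg (by linarith)
      (mul_nonneg (by linarith) (by linarith))),
      show 1 / ν * (1 / ((n : ℝ) + 1) ^ 2) = 1 / (((n : ℝ) + 1) * (ν * ((n : ℝ) + 1))) by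
        field_simp]
    gcongr
    · linarith
    · linarith
    · nlinarith

/-- This is the Mittag-Leffler series of `π cot (π z)` at `z = ν / 2`, with its terms paired
differently. -/
lemma hasSum_cot {ν : ℝ} (hν : ν ∈ Ioo (0 : ℝ) 1) :
    HasSum (fun n : ℕ => 1 / (2 * (n : ℝ) + 2 - ν) - 1 / (2 * (n : ℝ) + ν))
      (-(Real.pi * Real.cot (Real.pi * ν / 2)) / 2) := by
  obtain ⟨s1, s2⟩ := summable_one_div_sub_one_div hν
  obtain ⟨h0, h1⟩ := hν
  have hu : Summable (fun n : ℕ => 1 / (2 * (n : ℝ) + 2 - ν) - 1 / (2 * (n : ℝ) + ν)) :=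
    (s1.add s2).congr fun n => by ring
  -- Mittag-Leffler pairs `z - (n + 1)` with `z + (n + 1)`, while the series here pairs it with `z +
  -- n`. The shift is a telescoping series whose sum `2 / ν` is the polar term `1 / z`.
  have htele : HasSum (fun n : ℕ => 2 / (2 * (n : ℝ) + ν) - 2 / (2 * ((n + 1 : ℕ) : ℝ) + ν))
      (2 / ν) := by
    rw [hasSum_iff_tendsto_nat_of_nonneg]
    · have hlim : Tendsto (fun n : ℕ => 2 / ν - 2 / (2 * (n : ℝ) + ν)) atTop (𝓝 (2 / ν - 0)) := by
        refine tendsto_const_nhds.sub (tendsto_const_nhds.div_atTop ?_)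
        exact tendsto_atTop_add_const_right _ _
          (tendsto_natCast_atTop_atTop.const_mul_atTop two_pos)
      rw [sub_zero] at hlim
      refine hlim.congr fun n => ?_
      rw [Finset.sum_range_sub' (fun n : ℕ => 2 / (2 * (n : ℝ) + ν))]
      simp
    · intro n
      rw [sub_nonneg]
      have hn : (0 : ℝ) ≤ n := n.cast_nonneg
      push_cast
      gcongr
      linarith
  have ht := (hu.hasSum.mul_left (-2)).sub htele
  have hint : ((ν / 2 : ℝ) : ℂ) ∈ Complex.integerComplement := by
    rintro ⟨n, hn⟩
    have hn' : (n : ℝ) = ν / 2 := by exact_mod_cast hn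
    have a1 : (0 : ℝ) < n := by rw [hn']; linarith
    have a2 : (n : ℝ) < 1 := by rw [hn']; linarith
    have b1 : 0 < n := by exact_mod_cast a1
    have b2 : n < 1 := by exact_mod_cast a2
    omega
  have hcot := cot_series_rep' hint
  have hterm : ∀ n : ℕ, (1 / (((ν / 2 : ℝ) : ℂ) - (n + 1)) + 1 / (((ν / 2 : ℝ) : ℂ) + (n + 1))) =
      ((-2 * (1 / (2 * (n : ℝ) + 2 - ν) - 1 / (2 * (n : ℝ) + ν)) -
        (2 / (2 * (n : ℝ) + ν) - 2 / (2 * ((n + 1 : ℕ) : ℝ) + ν)) : ℝ) : ℂ) := by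
    intro n
    have hn : (0 : ℝ) ≤ n := n.cast_nonneg
    rw [show (1 / (((ν / 2 : ℝ) : ℂ) - (n + 1)) + 1 / (((ν / 2 : ℝ) : ℂ) + (n + 1))) =
      ((1 / (ν / 2 - (n + 1)) + 1 / (ν / 2 + (n + 1)) : ℝ) : ℂ) by push_cast; ring]
    congr 1
    have e1 : ν / 2 - ((n : ℝ) + 1) = -((2 * n + 2 - ν) / 2) := by ring
    have e2 : ν / 2 + ((n : ℝ) + 1) = (2 * (n + 1) + ν) / 2 := by ring
    rw [e1, e2]
    push_cast
    rw [one_div_neg_eq_neg_one_div, one_div_div, one_div_div]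
    ring
  simp only [hterm] at hcot
  rw [← Complex.ofReal_tsum, ht.tsum_eq, ← Complex.ofReal_mul, ← Complex.ofReal_cot,
    show (1 : ℂ) / ((ν / 2 : ℝ) : ℂ) = ((1 / (ν / 2) : ℝ) : ℂ) by push_cast; rfl,
    ← Complex.ofReal_mul, ← Complex.ofReal_sub, Complex.ofReal_inj] at hcot
  convert hu.hasSum using 1
  rw [one_div_div, show Real.pi * (ν / 2) = Real.pi * ν / 2 by ring] at hcot
  linarith

/-- The finite part of `∫_0^R (x ^ j + (-1) ^ k * (-x) ^ j) / x ^ (k + ν + 1) dx`. -/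
noncomputable def powerMoment (ν R : ℝ) (j k : ℕ) : ℂ :=
  (1 + (-1) ^ (k + j)) * ((R ^ ((j : ℝ) - k - ν) / ((j : ℝ) - k - ν) : ℝ) : ℂ)

/-- For `x < ω`, expand in powers of `x ^ 2 / ω ^ 2`. All terms are nonpositive because `1 - ν > 0`,
and the zero of the numerator at `ω` makes the termwise integrals `O(n ^ (-2))`. -/
lemma integral_quotient_left {ν ω : ℝ} (hν : ν ∈ Ioo (0 : ℝ) 1) (hω : 0 < ω) :
    HasSum (fun n : ℕ => ω ^ (-ν) * (1 / (2 * (n : ℝ) + 2 - ν) - 1 / (2 * (n : ℝ) + 1)))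
      (∫ x in (0 : ℝ)..ω, (x ^ (1 - ν) - ω ^ (1 - ν)) / (ω ^ 2 - x ^ 2)) := by
  obtain ⟨h0, h1⟩ := hν
  set F : ℕ → ℝ → ℝ := fun n x =>
    (ω ^ (2 * n + 2))⁻¹ * (x ^ (2 * (n : ℝ) + 1 - ν) - ω ^ (1 - ν) * x ^ (2 * n)) with hF
  have hFi : ∀ n, IntervalIntegrable (F n) volume 0 ω := fun n => by
    have hn : (0 : ℝ) ≤ n := n.cast_nonneg
    exact ((intervalIntegral.intervalIntegrable_rpow' (by linarith)).sub
      ((intervalIntegral.intervalIntegrable_pow _).const_mul _)).const_mul _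
  have hFint : ∀ n, ∫ x in (0 : ℝ)..ω, F n x =
      ω ^ (-ν) * (1 / (2 * (n : ℝ) + 2 - ν) - 1 / (2 * (n : ℝ) + 1)) := fun n => by
    have hn : (0 : ℝ) ≤ n := n.cast_nonneg
    rw [hF, intervalIntegral.integral_const_mul, intervalIntegral.integral_sub
      (intervalIntegral.intervalIntegrable_rpow' (by linarith))
      ((intervalIntegral.intervalIntegrable_pow _).const_mul _),
      intervalIntegral.integral_const_mul, integral_rpow (Or.inl (by linarith)), integral_pow,
      Real.zero_rpow (by linarith), zero_pow (by omega), sub_zero, sub_zero,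
      show 2 * (n : ℝ) + 1 - ν + 1 = -ν + ((2 * n + 2 : ℕ) : ℝ) by push_cast; ring,
      show 1 - ν = -ν + ((1 : ℕ) : ℝ) by push_cast; ring, Real.rpow_add_natCast hω.ne',
      Real.rpow_add_natCast hω.ne']
    have e1 : -ν + ((2 * n + 2 : ℕ) : ℝ) = 2 * n + 2 - ν := by push_cast; ring
    have e2 : ((2 * n : ℕ) : ℝ) + 1 = 2 * n + 1 := by push_cast; ring
    rw [e1, e2]
    have p1 : 2 * (n : ℝ) + 2 - ν ≠ 0 := by linarith
    have p2 : ω ^ (2 * n + 2) ≠ 0 := by positivity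
    field_simp
    rw [pow_succ ω (2 * n + 1)]
    ring
  have hFeq : ∀ n, ∀ x ∈ Ioo 0 ω, F n x =
      (x ^ (1 - ν) - ω ^ (1 - ν)) / ω ^ 2 * (x ^ 2 / ω ^ 2) ^ n := fun n x hx => by
    rw [hF]
    dsimp only
    rw [show 2 * (n : ℝ) + 1 - ν = (1 - ν) + ((2 * n : ℕ) : ℝ) by push_cast; ring,
      Real.rpow_add_natCast hx.1.ne', pow_add, div_pow, ← pow_mul, ← pow_mul]
    field_simp
  have hlt : ∀ x ∈ Ioo 0 ω, x ^ (1 - ν) ≤ ω ^ (1 - ν) := fun x hx =>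
    Real.rpow_le_rpow hx.1.le hx.2.le (by linarith)
  simp only [← hFint]
  refine hasSum_intervalIntegral_of_nonpos hω.le hFi (fun n x hx => ?_) ?_ fun x hx => ?_
  · rw [hFeq n x hx]
    exact mul_nonpos_of_nonpos_of_nonneg
      (div_nonpos_of_nonpos_of_nonneg (by linarith [hlt x hx]) (by positivity)) (by positivity)
  · simp only [hFint]
    exact (summable_one_div_sub_one_div ⟨h0, h1⟩).1.mul_left _
  · simp only [hFeq _ x hx]
    have hxω : x ^ 2 < ω ^ 2 := by
      have := hx.1; have := hx.2; gcongr
    have hg := (hasSum_geometric_of_lt_one (by positivity : 0 ≤ x ^ 2 / ω ^ 2)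
      ((div_lt_one (by positivity)).2 hxω)).mul_left ((x ^ (1 - ν) - ω ^ (1 - ν)) / ω ^ 2)
    have : ω ^ 2 - x ^ 2 ≠ 0 := by linarith
    have e : 1 - x ^ 2 / ω ^ 2 = (ω ^ 2 - x ^ 2) / ω ^ 2 := by field_simp
    rw [e, inv_div, div_mul_div_cancel₀ (by positivity)] at hg
    exact hg

lemma summable_even_kernel {ν ω R : ℝ} (hν : 0 < ν) (hω : 0 < ω) (hR : ω < R) :
    Summable fun n : ℕ => ω ^ (2 * n) * R ^ (-(2 * (n : ℝ)) - ν) / (2 * n + ν) := by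
  have hR0 : 0 < R := hω.trans hR
  have hg : Summable fun n : ℕ => R ^ (-ν) / ν * ((ω / R) ^ 2) ^ n := by
    refine (summable_geometric_of_lt_one (by positivity) ?_).mul_left _
    exact pow_lt_one₀ (by positivity) ((div_lt_one hR0).2 hR) two_ne_zero
  refine Summable.of_nonneg_of_le (fun n => by positivity) (fun n => ?_) hg
  have e : ω ^ (2 * n) * R ^ (-(2 * (n : ℝ)) - ν) = R ^ (-ν) * ((ω / R) ^ 2) ^ n := by
    rw [show -(2 * (n : ℝ)) - ν = -ν - ((2 * n : ℕ) : ℝ) by push_cast; ring,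
      Real.rpow_sub_natCast hR0.ne', ← pow_mul, div_pow]
    field_simp
  rw [e, div_mul_eq_mul_div]
  have hn : (0 : ℝ) ≤ n := n.cast_nonneg
  gcongr
  linarith

/-- For `x > ω`, expand in powers of `ω ^ 2 / x ^ 2`. The endpoint `R` contributes the moments of
the constant function and a logarithmic series. The endpoint `ω` contributes the remaining half of
the cotangent series. -/
lemma integral_quotient_right {ν ω R : ℝ} (hν : ν ∈ Ioo (0 : ℝ) 1) (hω : 0 < ω) (hR : ω < R) :
    HasSum (fun n : ℕ => ω ^ (2 * n) * R ^ (-(2 * (n : ℝ)) - ν) / (2 * n + ν)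
        - ω ^ (-ν) * (1 / (2 * (n : ℝ) + 1) * (ω / R) ^ (2 * n + 1))
        + ω ^ (-ν) * (1 / (2 * (n : ℝ) + 1) - 1 / (2 * (n : ℝ) + ν)))
      (∫ x in ω..R, (x ^ (1 - ν) - ω ^ (1 - ν)) / (ω ^ 2 - x ^ 2)) := by
  obtain ⟨h0, h1⟩ := hν
  have hR0 : 0 < R := hω.trans hR
  have h0m : (0 : ℝ) ∉ uIcc ω R := by
    rw [uIcc_of_le hR.le]
    exact fun h => absurd h.1 (not_le.2 hω)
  set F : ℕ → ℝ → ℝ := fun n x => ω ^ (2 * n) *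
    (ω ^ (1 - ν) * x ^ (-(2 * (n : ℝ)) - 2) - x ^ (-(2 * (n : ℝ)) - 1 - ν)) with hF
  have hrp : ∀ r : ℝ, IntervalIntegrable (fun x : ℝ => x ^ r) volume ω R := fun r =>
    intervalIntegral.intervalIntegrable_rpow (Or.inr h0m)
  have hFi : ∀ n, IntervalIntegrable (F n) volume ω R := fun n =>
    (((hrp _).const_mul _).sub (hrp _)).const_mul _
  have hFint : ∀ n, ∫ x in ω..R, F n x =
      ω ^ (2 * n) * R ^ (-(2 * (n : ℝ)) - ν) / (2 * n + ν)
        - ω ^ (-ν) * (1 / (2 * (n : ℝ) + 1) * (ω / R) ^ (2 * n + 1))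
        + ω ^ (-ν) * (1 / (2 * (n : ℝ) + 1) - 1 / (2 * (n : ℝ) + ν)) := fun n => by
    have hn : (0 : ℝ) ≤ n := n.cast_nonneg
    rw [hF, intervalIntegral.integral_const_mul, intervalIntegral.integral_sub
      ((hrp _).const_mul _) (hrp _), intervalIntegral.integral_const_mul,
      integral_rpow (Or.inr ⟨by linarith, h0m⟩), integral_rpow (Or.inr ⟨by linarith, h0m⟩),
      show -(2 * (n : ℝ)) - 2 + 1 = -((2 * n + 1 : ℕ) : ℝ) by push_cast; ring,
      show -(2 * (n : ℝ)) - 1 - ν + 1 = -(2 * (n : ℝ)) - ν by ring, Real.rpow_neg hR0.le,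
      Real.rpow_neg hω.le, Real.rpow_natCast, Real.rpow_natCast,
      show ω ^ (-(2 * (n : ℝ)) - ν) = ω ^ (-ν) / ω ^ (2 * n) by
        rw [show -(2 * (n : ℝ)) - ν = -ν - ((2 * n : ℕ) : ℝ) by push_cast; ring,
          Real.rpow_sub_natCast hω.ne'],
      show 1 - ν = -ν + ((1 : ℕ) : ℝ) by push_cast; ring, Real.rpow_add_natCast hω.ne', pow_one,
      show -(2 * (n : ℝ)) - ν = -(2 * n + ν) by ring, div_pow, pow_succ ω]
    have e2 : ((2 * n + 1 : ℕ) : ℝ) = 2 * n + 1 := by push_cast; ring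
    rw [e2]
    have p1 : 2 * (n : ℝ) + ν ≠ 0 := by linarith
    have p2 : ω ^ (2 * n) ≠ 0 := by positivity
    field_simp
    ring
  have hFeq : ∀ n, ∀ x ∈ Ioo ω R, F n x =
      (ω ^ (1 - ν) - x ^ (1 - ν)) / x ^ 2 * (ω ^ 2 / x ^ 2) ^ n := fun n x hx => by
    have hx0 : 0 < x := hω.trans hx.1
    rw [hF]
    dsimp only
    rw [show -(2 * (n : ℝ)) - 2 = -((2 * n + 2 : ℕ) : ℝ) by push_cast; ring, Real.rpow_neg hx0.le,
      Real.rpow_natCast,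
      show -(2 * (n : ℝ)) - 1 - ν = (1 - ν) - ((2 * n + 2 : ℕ) : ℝ) by push_cast; ring,
      Real.rpow_sub_natCast hx0.ne', pow_add, div_pow, ← pow_mul, ← pow_mul]
    field_simp
  have hlt : ∀ x ∈ Ioo ω R, ω ^ (1 - ν) ≤ x ^ (1 - ν) := fun x hx =>
    Real.rpow_le_rpow hω.le hx.1.le (by linarith)
  simp only [← hFint]
  refine hasSum_intervalIntegral_of_nonpos hR.le hFi (fun n x hx => ?_) ?_ fun x hx => ?_
  · rw [hFeq n x hx]
    exact mul_nonpos_of_nonpos_of_nonneg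
      (div_nonpos_of_nonpos_of_nonneg (by linarith [hlt x hx]) (by positivity)) (by positivity)
  · simp only [hFint]
    have hq : |ω / R| < 1 := by
      rw [abs_of_pos (by positivity)]
      exact (div_lt_one hR0).2 hR
    have s1 := (Real.hasSum_log_sub_log_of_abs_lt_one hq).summable.mul_left (ω ^ (-ν) / 2)
    have s2 := (summable_one_div_sub_one_div ⟨h0, h1⟩).2.mul_left (ω ^ (-ν))
    have s3 := summable_even_kernel h0 hω hR
    refine ((s3.sub s1).add s2).congr fun n => ?_
    ring
  · have hx0 : 0 < x := hω.trans hx.1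
    simp only [hFeq _ x hx]
    have hxω : ω ^ 2 < x ^ 2 := by
      have := hx.1; gcongr
    have hg := (hasSum_geometric_of_lt_one (by positivity : 0 ≤ ω ^ 2 / x ^ 2)
      ((div_lt_one (by positivity)).2 hxω)).mul_left ((ω ^ (1 - ν) - x ^ (1 - ν)) / x ^ 2)
    have : ω ^ 2 - x ^ 2 ≠ 0 := by linarith
    have e : 1 - ω ^ 2 / x ^ 2 = (x ^ 2 - ω ^ 2) / x ^ 2 := by field_simp
    have e3 : (ω ^ (1 - ν) - x ^ (1 - ν)) / (x ^ 2 - ω ^ 2) =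
        (x ^ (1 - ν) - ω ^ (1 - ν)) / (ω ^ 2 - x ^ 2) := by
      rw [← neg_sub (x ^ (1 - ν)), ← neg_sub (ω ^ 2), neg_div_neg_eq]
    rw [e, inv_div, div_mul_div_cancel₀ (by positivity), e3] at hg
    exact hg

/-! ### Subtracting the singularity at `ω` -/

lemma hilbertIntegrand_one_sub {ν ω x : ℝ} (hx : x ≠ ω) :
    hilbertIntegrand ν (fun _ => 1) ω x =
      (((Real.sign x * |x| ^ (-ν) - ω ^ (-ν)) / (ω - x) : ℝ) : ℂ) +
        ((ω ^ (-ν) : ℝ) : ℂ) * (1 / ((ω : ℂ) - (x : ℂ))) := by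
  have h : (ω : ℂ) - x ≠ 0 := by
    rw [sub_ne_zero]
    exact_mod_cast hx.symm
  rw [hilbertIntegrand, Real.rpow_neg (abs_nonneg x)]
  push_cast
  field_simp
  ring

lemma integrableOn_sign_quotient {ν ω R : ℝ} (hν : ν ∈ Ioo (0 : ℝ) 1) (hω : 0 < ω) (hR : ω < R) :
    IntegrableOn (fun x : ℝ => (Real.sign x * |x| ^ (-ν) - ω ^ (-ν)) / (ω - x))
      (Icc (-R) R) := by
  obtain ⟨h0, h1⟩ := hν
  have hR0 : 0 < R := hω.trans hR
  have hw : IntegrableOn (fun x : ℝ => Real.sign x * |x| ^ (-ν)) (Icc (-R) R) := by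
    refine Integrable.mono (integrableOn_abs_rpow_neg h1 hR0.le) ?_ (ae_of_all _ fun x => ?_)
    · have : Measurable fun x : ℝ => |x| ^ (-ν) := by fun_prop
      exact (measurable_sign.mul this).aestronglyMeasurable
    · rw [norm_mul]
      exact mul_le_of_le_one_left (norm_nonneg _) (abs_sign_le_one x)
  -- The two singular points are separated. Left of `ω / 2` the factor `1 / (ω - x)` is continuous,
  -- and right of it the quotient is, off `ω`, minus the continuous difference quotient of `x ^
  -- (-ν)`.
  have hsplit : Icc (-R) R = Icc (-R) (ω / 2) ∪ Icc (ω / 2) R :=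
    (Icc_union_Icc_eq_Icc (by linarith) (by linarith)).symm
  rw [hsplit]
  refine IntegrableOn.union ?_ ?_
  · have hw' := (hw.sub (integrableOn_const (C := ω ^ (-ν)) (by simp))).mono_set
      (Icc_subset_Icc_right (by linarith) : Icc (-R) (ω / 2) ⊆ Icc (-R) R)
    simp only [div_eq_mul_inv]
    refine IntegrableOn.mul_continuousOn hw' ?_ isCompact_Icc
    refine (continuousOn_const.sub continuousOn_id).inv₀ fun x hx => ?_
    have := hx.2
    show ω - x ≠ 0
    linarith
  · have hc : ContinuousOn (dslope (fun x : ℝ => x ^ (-ν)) ω) (Icc (ω / 2) R) := by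
      refine (continuousOn_dslope (Icc_mem_nhds (by linarith) hR)).2 ⟨?_, ?_⟩
      · exact continuousOn_id.rpow_const fun x hx => Or.inl (by simp only [id]; linarith [hx.1])
      · exact (Real.hasDerivAt_rpow_const (Or.inl hω.ne')).differentiableAt
    refine (hc.neg.integrableOn_compact isCompact_Icc).congr ?_
    have hne : ∀ᵐ x ∂(volume.restrict (Icc (ω / 2) R)), x ≠ ω :=
      ae_restrict_of_ae (Measure.ae_ne volume ω)
    filter_upwards [hne, ae_restrict_mem measurableSet_Icc] with x hx hxm
    have hx0 : 0 < x := by linarith [hxm.1]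
    rw [Pi.neg_apply, dslope_of_ne _ hx, slope_def_field, Real.sign_of_pos hx0, abs_of_pos hx0, one_mul,
      ← neg_sub x ω, div_neg]

lemma hasPVOn_const_pos {ν ω R : ℝ} (hν : ν ∈ Ioo (0 : ℝ) 1) (hω : 0 < ω) (hR : ω < R) :
    HasPVOn (hilbertIntegrand ν (fun _ => 1) ω) ω R
      ((2 * (∑' n : ℕ, ω ^ (2 * n) * R ^ (-(2 * (n : ℝ)) - ν) / (2 * n + ν)) -
        Real.pi * Real.cot (Real.pi * ν / 2) * ω ^ (-ν) : ℝ) : ℂ) := by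
  have hR0 : 0 < R := hω.trans hR
  have hint := integrableOn_sign_quotient hν hω hR
  have hq : |ω / R| < 1 := by
    rw [abs_of_pos (by positivity)]
    exact (div_lt_one hR0).2 hR
  have hA := integral_quotient_left hν hω
  have hB := integral_quotient_right hν hω hR
  have s1 := (Real.hasSum_log_sub_log_of_abs_lt_one hq).mul_left (ω ^ (-ν) / 2)
  have s3 := (summable_even_kernel hν.1 hω hR).hasSum
  have s4 := (hasSum_cot hν).mul_left (ω ^ (-ν))
  -- The terms `1 / (2 n + 1)` of the two halves cancel, leaving the even moments, the logarithm and
  -- the cotangent series.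
  have hval := (hA.add hB).unique (((s3.sub s1).add s4).congr_fun fun n => by ring)
  have hlog : Real.log (1 + ω / R) - Real.log (1 - ω / R) = Real.log ((R + ω) / (R - ω)) := by
    rw [← Real.log_div (by positivity) (by linarith [(abs_lt.1 hq).2])]
    congr 1
    have : R - ω ≠ 0 := by linarith
    field_simp
  rw [hlog] at hval
  obtain ⟨hsi, hsv⟩ := setIntegral_Icc_neg_eq hR0.le hint
  have hcongr : ∀ᵐ x : ℝ, x ∈ Ioc 0 R → (Real.sign x * |x| ^ (-ν) - ω ^ (-ν)) / (ω - x) +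
      (Real.sign (-x) * |(-x)| ^ (-ν) - ω ^ (-ν)) / (ω - -x) =
      2 * ((x ^ (1 - ν) - ω ^ (1 - ν)) / (ω ^ 2 - x ^ 2)) := by
    filter_upwards [Measure.ae_ne volume ω] with x hxω hx
    have hx0 : 0 < x := hx.1
    rw [abs_neg, abs_of_pos hx0, Real.sign_of_pos hx0, Real.sign_of_neg (by linarith),
      show 1 - ν = -ν + ((1 : ℕ) : ℝ) by push_cast; ring, Real.rpow_add_natCast hω.ne',
      Real.rpow_add_natCast hx0.ne', show ω ^ 2 - x ^ 2 = (ω - x) * (ω - -x) by ring]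
    have e1 : ω - x ≠ 0 := sub_ne_zero.2 hxω.symm
    have e2 : ω - -x ≠ 0 := by linarith
    field_simp
    ring
  have hci : IntervalIntegrable (fun x : ℝ => 2 * ((x ^ (1 - ν) - ω ^ (1 - ν)) /
      (ω ^ 2 - x ^ 2))) volume 0 R := by
    refine hsi.congr_ae ?_
    rw [uIoc_of_le hR0.le]
    exact (ae_restrict_iff' measurableSet_Ioc).2 hcongr
  have hci' : IntervalIntegrable (fun x : ℝ => (x ^ (1 - ν) - ω ^ (1 - ν)) /
      (ω ^ 2 - x ^ 2)) volume 0 R := by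
    simpa [← mul_assoc] using hci.const_mul (1 / 2)
  rw [intervalIntegral.integral_congr_ae (by rwa [uIoc_of_le hR0.le]),
    intervalIntegral.integral_const_mul,
    ← intervalIntegral.integral_add_adjacent_intervals (b := ω)
      (hci'.mono_set (uIcc_subset_uIcc left_mem_uIcc
        (by rw [uIcc_of_le hR0.le]; exact ⟨hω.le, hR.le⟩)))
      (hci'.mono_set (uIcc_subset_uIcc
        (by rw [uIcc_of_le hR0.le]; exact ⟨hω.le, hR.le⟩) right_mem_uIcc)), hval] at hsv
  have hreg := hasPVOn_of_integrableOn (ω := ω) (h := fun x : ℝ =>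
    (((Real.sign x * |x| ^ (-ν) - ω ^ (-ν)) / (ω - x) : ℝ) : ℂ)) (b := R) hint.ofReal
  rw [integral_complex_ofReal, hsv] at hreg
  have := hreg.add ((hasPVOn_one_div_sub (by rwa [abs_of_pos hω])).const_mul ((ω ^ (-ν) : ℝ) : ℂ))
  convert this.congr fun x _ hx => (hilbertIntegrand_one_sub hx).symm using 1
  push_cast
  ring

lemma hilbertIntegrand_neg (ν : ℝ) (f : ℝ → ℂ) (ω x : ℝ) :
    hilbertIntegrand ν f ω (-x) = hilbertIntegrand ν (fun y => f (-y)) (-ω) x := by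
  rw [hilbertIntegrand, hilbertIntegrand, abs_neg, Real.sign_neg]
  push_cast
  rw [show (ω : ℂ) - -x = -(-ω - x) by ring, mul_neg, div_neg, neg_mul, neg_div, neg_neg]

lemma powerMoment_zero_even (ν R : ℝ) (n : ℕ) : powerMoment ν R 0 (2 * n) =
    ((-2 * (R ^ (-(2 * (n : ℝ)) - ν) / (2 * n + ν)) : ℝ) : ℂ) := by
  rw [powerMoment, add_zero, pow_mul, neg_one_sq, one_pow,
    show ((0 : ℕ) : ℝ) - ((2 * n : ℕ) : ℝ) - ν = -(2 * n + ν) by push_cast; ring, div_neg,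
    show -(2 * (n : ℝ)) - ν = -(2 * n + ν) by ring]
  push_cast
  ring

lemma powerMoment_odd {ν R : ℝ} {j k : ℕ} (h : Odd (k + j)) : powerMoment ν R j k = 0 := by
  rw [powerMoment, h.neg_one_pow, add_neg_cancel, zero_mul]

/-- Reflection `x ↦ -x` flips both `sgn x` and `ω - x` up to replacing `ω` by `-ω`, so the value is
even in `ω`. This matches the vanishing of the odd moments. -/
lemma hasPVOn_const {ν ω R : ℝ} (hν : ν ∈ Ioo (0 : ℝ) 1) (hω : ω ≠ 0) (hR : |ω| < R) :
    ∃ S : ℂ, HasSum (fun k : ℕ => (ω : ℂ) ^ k * powerMoment ν R 0 k) S ∧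
    HasPVOn (hilbertIntegrand ν (fun _ => 1) ω) ω R
      (-S - ((Real.pi * Real.cot (Real.pi * ν / 2) : ℝ) : ℂ) * (1 / ((|ω| ^ ν : ℝ) : ℂ))) := by
  have hω' : 0 < |ω| := abs_pos.2 hω
  obtain ⟨T, hs⟩ := summable_even_kernel hν.1 hω' hR
  have hpv := hasPVOn_const_pos hν hω' hR
  rw [hs.tsum_eq] at hpv
  refine ⟨((-2 * T : ℝ) : ℂ), ?_, ?_⟩
  · have h1 : HasSum (fun n : ℕ => (ω : ℂ) ^ (2 * n) * powerMoment ν R 0 (2 * n))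
        ((-2 * T : ℝ) : ℂ) := by
      have := Complex.hasSum_ofReal.2 (hs.mul_left (-2))
      refine this.congr_fun fun n => ?_
      rw [powerMoment_zero_even, pow_mul |ω|, sq_abs, ← pow_mul]
      push_cast
      ring
    have h2 : HasSum (fun n : ℕ => (ω : ℂ) ^ (2 * n + 1) * powerMoment ν R 0 (2 * n + 1)) 0 := by
      refine hasSum_zero.congr_fun fun n => ?_
      rw [powerMoment_odd (by simp), mul_zero]
    have h3 := HasSum.even_add_odd (f := fun k : ℕ => (ω : ℂ) ^ k * powerMoment ν R 0 k) h1 h2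
    rwa [add_zero] at h3
  · have hv : -((-2 * T : ℝ) : ℂ) - ((Real.pi * Real.cot (Real.pi * ν / 2) : ℝ) : ℂ) *
        (1 / ((|ω| ^ ν : ℝ) : ℂ)) =
        ((2 * T - Real.pi * Real.cot (Real.pi * ν / 2) * |ω| ^ (-ν) : ℝ) : ℂ) := by
      rw [Real.rpow_neg hω'.le]
      push_cast
      ring
    rw [hv]
    rcases lt_or_gt_of_ne hω with h | h
    · rw [abs_of_neg h] at hpv ⊢
      have := hpv.comp_neg
      simp only [hilbertIntegrand_neg, neg_neg] at this
      exact this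
    · rwa [abs_of_pos h] at hpv ⊢

/-! ### Power series -/

/-- The left side is the distance from `ν` to the integers. It keeps the denominators of
`powerMoment` uniformly away from `0`. -/
lemma min_le_abs_natCast_sub {ν : ℝ} (hν : ν ∈ Ioo (0 : ℝ) 1) (j k : ℕ) :
    min ν (1 - ν) ≤ |(j : ℝ) - k - ν| := by
  rcases le_or_gt j k with h | h
  · have h' : (j : ℝ) ≤ k := by exact_mod_cast h
    rw [abs_of_neg (by linarith [hν.1])]
    exact (min_le_left _ _).trans (by linarith)
  · have h' : (k : ℝ) + 1 ≤ j := by exact_mod_cast h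
    exact (min_le_right _ _).trans ((by linarith : 1 - ν ≤ (j : ℝ) - k - ν).trans (le_abs_self _))

lemma natCast_sub_ne {ν : ℝ} (hν : ν ∈ Ioo (0 : ℝ) 1) (j k : ℕ) : (j : ℝ) - k - ν ≠ 0 :=
  abs_pos.1 ((lt_min hν.1 (by linarith [hν.2])).trans_le (min_le_abs_natCast_sub hν j k))

lemma norm_one_add_neg_one_pow_le (n : ℕ) : ‖(1 : ℂ) + (-1) ^ n‖ ≤ 2 := by
  refine (norm_add_le _ _).trans ?_
  rw [norm_pow, norm_neg, norm_one, one_pow]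
  norm_num

/-- The bound separates into a factor in `j` and a factor in `k`, so the double series is dominated
by a product of two convergent series. -/
lemma norm_powerMoment_le {ν : ℝ} (hν : ν ∈ Ioo (0 : ℝ) 1) {R : ℝ} (hR : 0 < R) (j k : ℕ) :
    ‖powerMoment ν R j k‖ ≤ R ^ j * (2 * (R ^ (-ν) / min ν (1 - ν))) * (R ^ k)⁻¹ := by
  have hδ : 0 < min ν (1 - ν) := lt_min hν.1 (by linarith [hν.2])
  have e : R ^ ((j : ℝ) - k - ν) = R ^ j * R ^ (-ν) * (R ^ k)⁻¹ := by
    rw [show (j : ℝ) - k - ν = -ν + j - k by ring, Real.rpow_sub_natCast hR.ne',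
      Real.rpow_add_natCast hR.ne']
    ring
  rw [powerMoment, norm_mul, Complex.norm_real, norm_div, Real.norm_of_nonneg (by positivity),
    Real.norm_eq_abs, e]
  calc ‖(1 : ℂ) + (-1) ^ (k + j)‖ * (R ^ j * R ^ (-ν) * (R ^ k)⁻¹ / |(j : ℝ) - k - ν|)
      ≤ 2 * (R ^ j * R ^ (-ν) * (R ^ k)⁻¹ / min ν (1 - ν)) := by
        gcongr
        · exact norm_one_add_neg_one_pow_le _
        · exact min_le_abs_natCast_sub hν j k
    _ = _ := by ring

lemma powerMoment_succ_succ (ν R : ℝ) (j k : ℕ) :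
    powerMoment ν R (j + 1) (k + 1) = powerMoment ν R j k := by
  rw [powerMoment, powerMoment, show k + 1 + (j + 1) = k + j + 2 by ring, pow_add, neg_one_sq,
    mul_one]
  push_cast
  rw [add_sub_add_right_eq_sub, add_sub_add_right_eq_sub]

lemma integral_sign_mul_pow {ν R : ℝ} (hν : ν ∈ Ioo (0 : ℝ) 1) (hR : 0 < R) (j : ℕ) :
    IntegrableOn (fun x : ℝ => (Real.sign x : ℂ) * (x : ℂ) ^ j / ((|x| ^ ν : ℝ) : ℂ))
      (Icc (-R) R) ∧
    ∫ x in Icc (-R) R, (Real.sign x : ℂ) * (x : ℂ) ^ j / ((|x| ^ ν : ℝ) : ℂ) =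
      powerMoment ν R (j + 1) 0 := by
  have hc : Continuous fun x : ℝ => (x : ℂ) ^ j := by fun_prop
  have hi := integrableOn_sign_mul_div hν.2 hR.le (g := fun x : ℝ => (x : ℂ) ^ j) (C := R ^ j)
    hc.aestronglyMeasurable fun x hx => by
      rw [norm_pow, Complex.norm_real, Real.norm_eq_abs]
      exact pow_le_pow_left₀ (abs_nonneg _) (abs_le.2 hx) _
  refine ⟨hi, ?_⟩
  rw [(setIntegral_Icc_neg_eq hR.le hi).2]
  have hcongr : ∀ x ∈ Ioc 0 R, (Real.sign x : ℂ) * (x : ℂ) ^ j / ((|x| ^ ν : ℝ) : ℂ) +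
      (Real.sign (-x) : ℂ) * ((-x : ℝ) : ℂ) ^ j / ((|(-x)| ^ ν : ℝ) : ℂ) =
      (1 + (-1) ^ (0 + (j + 1))) * ((x ^ ((j : ℝ) - ν) : ℝ) : ℂ) := fun x hx => by
    have hx0 : 0 < x := hx.1
    have hxν : ((x ^ ν : ℝ) : ℂ) ≠ 0 := by
      exact_mod_cast (Real.rpow_pos_of_pos hx0 ν).ne'
    rw [abs_neg, abs_of_pos hx0, Real.sign_of_pos hx0, Real.sign_of_neg (by linarith),
      Real.rpow_sub hx0, Real.rpow_natCast]
    push_cast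
    rw [neg_pow (x : ℂ)]
    field_simp
    ring
  rw [intervalIntegral.integral_of_le hR.le, setIntegral_congr_fun measurableSet_Ioc hcongr,
    ← intervalIntegral.integral_of_le hR.le, intervalIntegral.integral_const_mul,
    intervalIntegral.integral_ofReal, integral_rpow (Or.inl (by
      have : (0 : ℝ) ≤ j := j.cast_nonneg
      linarith [hν.2])), powerMoment]
  have hne : (j : ℝ) - ν + 1 ≠ 0 := by
    have : (0 : ℝ) ≤ j := j.cast_nonneg
    linarith [hν.2]
  rw [Real.zero_rpow hne, sub_zero]
  congr 2
  push_cast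
  rw [show (j : ℝ) + 1 - 0 - ν = j - ν + 1 by ring]

/-- Induction by `x ^ (j + 1) / (ω - x) = ω x ^ j / (ω - x) - x ^ j`. Multiplying by `ω` shifts the
series, since moments depend only on `j - k`, and the integral of the leftover `x ^ j` supplies the
new term `k = 0`. -/
lemma hasPVOn_monomial {ν ω R : ℝ} (hν : ν ∈ Ioo (0 : ℝ) 1) (hω : ω ≠ 0) (hR : |ω| < R) (j : ℕ) :
    ∃ S : ℂ, HasSum (fun k : ℕ => (ω : ℂ) ^ k * powerMoment ν R j k) S ∧
    HasPVOn (hilbertIntegrand ν (fun x => (x : ℂ) ^ j) ω) ω R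
      (-S - ((Real.pi * Real.cot (Real.pi * ν / 2) : ℝ) : ℂ) *
        ((ω : ℂ) ^ j / ((|ω| ^ ν : ℝ) : ℂ))) := by
  have hR0 : 0 < R := (abs_nonneg ω).trans_lt hR
  induction j with
  | zero => simpa using hasPVOn_const hν hω hR
  | succ j ih =>
    obtain ⟨S, hS, hpv⟩ := ih
    refine ⟨powerMoment ν R (j + 1) 0 + ω * S, ?_, ?_⟩
    · have h1 : HasSum (fun k : ℕ => (ω : ℂ) ^ (k + 1) * powerMoment ν R (j + 1) (k + 1))
          (ω * S) := by
        refine (hS.mul_left (ω : ℂ)).congr_fun fun k => ?_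
        rw [powerMoment_succ_succ, pow_succ]
        ring
      have h2 := h1.zero_add (f := fun k : ℕ => (ω : ℂ) ^ k * powerMoment ν R (j + 1) k)
      simpa using h2
    · obtain ⟨hi, hv⟩ := integral_sign_mul_pow hν hR0 j
      have h1 := (hpv.const_mul (ω : ℂ)).add ((hasPVOn_of_integrableOn (ω := ω) hi).const_mul (-1))
      rw [hv] at h1
      convert h1.congr fun x _ hx => ?_ using 1
      · ring
      · have hne : (ω : ℂ) - x ≠ 0 := by
          rw [sub_ne_zero]
          exact_mod_cast hx.symm
        by_cases hx0 : x = 0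
        · simp [hx0, hilbertIntegrand]
        have hxν : ((|x| ^ ν : ℝ) : ℂ) ≠ 0 := by
          exact_mod_cast (Real.rpow_pos_of_pos (abs_pos.2 hx0) ν).ne'
        rw [hilbertIntegrand, hilbertIntegrand, pow_succ]
        field_simp
        ring

/-- `f` is the sum of the power series with coefficients `α`, absolutely convergent on
`[-R, R]`. -/
def HasExpansionOn (α : ℕ → ℂ) (f : ℝ → ℂ) (R : ℝ) : Prop :=
  Summable (fun n => ‖α n‖ * R ^ n) ∧ ∀ x : ℝ, |x| ≤ R → HasSum (fun n => α n * (x : ℂ) ^ n) (f x)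

lemma HasExpansionOn.continuousOn {α : ℕ → ℂ} {f : ℝ → ℂ} {R : ℝ} (h : HasExpansionOn α f R) :
    ContinuousOn f (Icc (-R) R) := by
  have hc : ContinuousOn (fun x : ℝ => ∑' n, α n * (x : ℂ) ^ n) (Icc (-R) R) := by
    refine continuousOn_tsum (fun n => by fun_prop) h.1 fun n x hx => ?_
    rw [norm_mul, norm_pow, Complex.norm_real, Real.norm_eq_abs]
    have := abs_le.2 hx
    gcongr
  exact hc.congr fun x hx => (h.2 x (abs_le.2 hx)).tsum_eq.symm

/-- Summing the geometric sum exactly, rather than bounding it by `j` times its largest term, avoids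
a factor `j`. Summability of `‖α j‖ R ^ j` is then enough. -/
lemma norm_pow_sub_pow_div_le {x ω R : ℝ} (hx : |x| ≤ R) (hω : |ω| < R) (j : ℕ) :
    ‖((x : ℂ) ^ j - (ω : ℂ) ^ j) / ((ω : ℂ) - x)‖ ≤ R ^ j * (R - |ω|)⁻¹ := by
  have hR0 : 0 < R := (abs_nonneg ω).trans_lt hω
  have hpos : 0 < R - |ω| := by linarith
  by_cases hxω : x = ω
  · subst hxω
    simp only [sub_self, div_zero, norm_zero]
    positivity
  have hne : (ω : ℂ) - x ≠ 0 := by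
    rw [sub_ne_zero]
    exact_mod_cast Ne.symm hxω
  have e : ((x : ℂ) ^ j - (ω : ℂ) ^ j) / ((ω : ℂ) - x) =
      -∑ i ∈ Finset.range j, (x : ℂ) ^ i * (ω : ℂ) ^ (j - 1 - i) := by
    rw [div_eq_iff hne, ← geom_sum₂_mul]
    ring
  rw [e, norm_neg]
  have hle : ‖∑ i ∈ Finset.range j, (x : ℂ) ^ i * (ω : ℂ) ^ (j - 1 - i)‖ ≤
      ∑ i ∈ Finset.range j, R ^ i * |ω| ^ (j - 1 - i) := by
    refine norm_sum_le_of_le _ fun i _ => ?_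
    rw [norm_mul, norm_pow, norm_pow, Complex.norm_real, Complex.norm_real, Real.norm_eq_abs,
      Real.norm_eq_abs]
    gcongr
  refine hle.trans ?_
  rw [← div_eq_mul_inv, le_div_iff₀ hpos, geom_sum₂_mul]
  have : 0 ≤ |ω| ^ j := by positivity
  linarith

lemma summable_double_series {ν ω R : ℝ} (hν : ν ∈ Ioo (0 : ℝ) 1) (hR : |ω| < R)
    {α : ℕ → ℂ} (hα : Summable (fun n => ‖α n‖ * R ^ n)) :
    Summable (fun p : ℕ × ℕ => α p.1 * ((ω : ℂ) ^ p.2 * powerMoment ν R p.1 p.2)) := by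
  have hR0 : 0 < R := (abs_nonneg ω).trans_lt hR
  have hδ : 0 < min ν (1 - ν) := lt_min hν.1 (by linarith [hν.2])
  have hg : Summable fun k : ℕ => 2 * (R ^ (-ν) / min ν (1 - ν)) * (|ω| / R) ^ k :=
    (summable_geometric_of_lt_one (by positivity) ((div_lt_one hR0).2 hR)).mul_left _
  refine Summable.of_norm_bounded (hα.mul_of_nonneg hg (fun n => by positivity)
    (fun k => by positivity)) ?_
  rintro ⟨j, k⟩
  rw [norm_mul, norm_mul, norm_pow, Complex.norm_real, Real.norm_eq_abs]
  calc ‖α j‖ * (|ω| ^ k * ‖powerMoment ν R j k‖)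
      ≤ ‖α j‖ * (|ω| ^ k * (R ^ j * (2 * (R ^ (-ν) / min ν (1 - ν))) * (R ^ k)⁻¹)) := by
        gcongr
        exact norm_powerMoment_le hν hR0 j k
    _ = _ := by
        rw [div_pow]
        ring

lemma summable_mul_powerMoment {ν R : ℝ} (hν : ν ∈ Ioo (0 : ℝ) 1) (hR : 0 < R)
    {α : ℕ → ℂ} (hα : Summable (fun n => ‖α n‖ * R ^ n)) (k : ℕ) :
    Summable (fun j => α j * powerMoment ν R j k) := by
  refine Summable.of_norm_bounded
    (hα.mul_right ((2 * (R ^ (-ν) / min ν (1 - ν))) * (R ^ k)⁻¹)) fun j => ?_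
  rw [norm_mul]
  calc ‖α j‖ * ‖powerMoment ν R j k‖ ≤
        ‖α j‖ * (R ^ j * (2 * (R ^ (-ν) / min ν (1 - ν))) * (R ^ k)⁻¹) := by
        gcongr
        exact norm_powerMoment_le hν hR j k
    _ = _ := by ring

/-- Termwise passage is not available for the principal value itself. It is carried out on the
absolutely convergent integral of `(f x - f ω) / (ω - x)`; the singular remainder is `f ω` times the
case of the constant function. -/
lemma HasExpansionOn.hasPVOn {ν ω R : ℝ} (hν : ν ∈ Ioo (0 : ℝ) 1) (hω : ω ≠ 0) (hR : |ω| < R)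
    {α : ℕ → ℂ} {f : ℝ → ℂ} (h : HasExpansionOn α f R) :
    ∃ S : ℂ, HasSum (fun k : ℕ => (ω : ℂ) ^ k * ∑' j, α j * powerMoment ν R j k) S ∧
    HasPVOn (hilbertIntegrand ν f ω) ω R
      (-S - ((Real.pi * Real.cot (Real.pi * ν / 2) : ℝ) : ℂ) *
        (f ω / ((|ω| ^ ν : ℝ) : ℂ))) := by
  have hR0 : 0 < R := (abs_nonneg ω).trans_lt hR
  choose S hS hpv using hasPVOn_monomial hν hω hR
  have hfω := h.2 ω hR.le
  -- the double series
  have hM := summable_double_series hν hR h.1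
  obtain ⟨T, hT⟩ := hM
  have hT1 : HasSum (fun j => α j * S j) T := hT.prod_fiberwise fun j => (hS j).mul_left (α j)
  have hT2 : HasSum (fun k : ℕ => (ω : ℂ) ^ k * ∑' j, α j * powerMoment ν R j k) T := by
    have hsw : HasSum (fun p : ℕ × ℕ => α p.2 * ((ω : ℂ) ^ p.1 * powerMoment ν R p.2 p.1)) T :=
      (Equiv.prodComm ℕ ℕ).hasSum_iff.2 hT
    refine hsw.prod_fiberwise fun k => ?_
    refine ((summable_mul_powerMoment hν hR0 h.1 k).hasSum.mul_left ((ω : ℂ) ^ k)).congr_fun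
      fun j => ?_
    ring
  refine ⟨T, hT2, ?_⟩
  -- the regular part
  set q : (ℝ → ℂ) → ℝ → ℂ := fun g x =>
    (Real.sign x : ℂ) * ((g x - g ω) / ((ω : ℂ) - x)) / ((|x| ^ ν : ℝ) : ℂ) with hq
  have hqpv : ∀ (g : ℝ → ℂ) (x : ℝ), q g x = hilbertIntegrand ν g ω x +
      (-g ω) * hilbertIntegrand ν (fun _ => 1) ω x := fun g x => by
    simp only [hq, hilbertIntegrand]
    rw [mul_div_assoc', div_div, mul_comm ((ω : ℂ) - x)]
    ring
  have hmeas : ∀ g : ℝ → ℂ, ContinuousOn g (Icc (-R) R) → AEStronglyMeasurable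
      (fun x : ℝ => (g x - g ω) / ((ω : ℂ) - x)) (volume.restrict (Icc (-R) R)) := fun g hg => by
    have h1 := (hg.aestronglyMeasurable (μ := volume) measurableSet_Icc).sub
      (aestronglyMeasurable_const (b := g ω))
    have h2 : Measurable fun x : ℝ => ((ω : ℂ) - x)⁻¹ := by fun_prop
    simp only [div_eq_mul_inv]
    exact h1.mul h2.aestronglyMeasurable
  have hqj : ∀ j : ℕ, IntegrableOn (q fun x => (x : ℂ) ^ j) (Icc (-R) R) := fun j =>
    integrableOn_sign_mul_div hν.2 hR0.le (hmeas _ (by fun_prop))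
      fun x hx => norm_pow_sub_pow_div_le (abs_le.2 hx) hR j
  -- The integral is read off from the principal values for `x ^ j` and `1`, whose cotangent terms
  -- cancel.
  have hqjv : ∀ j : ℕ, ∫ x in Icc (-R) R, q (fun x => (x : ℂ) ^ j) x =
      -S j + (ω : ℂ) ^ j * S 0 := fun j => by
    have h1 := (hpv j).add ((hpv 0).const_mul (-(ω : ℂ) ^ j))
    simp only [pow_zero] at h1
    rw [(hasPVOn_of_integrableOn (ω := ω) (hqj j)).unique (h1.congr fun x _ _ => ?_)]
    · ring
    · exact (hqpv _ x).symm
  have hterm : ∀ x ∈ Icc (-R) R, HasSum (fun j => α j * (((x : ℂ) ^ j - (ω : ℂ) ^ j) /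
      ((ω : ℂ) - x))) ((f x - f ω) / ((ω : ℂ) - x)) := fun x hx => by
    refine (((h.2 x (abs_le.2 hx)).sub hfω).div_const _).congr_fun fun j => ?_
    ring
  have hb : Summable fun j => ‖α j‖ * R ^ j * (R - |ω|)⁻¹ := h.1.mul_right _
  have hnorm : ∀ x ∈ Icc (-R) R, ∀ j, ‖α j * (((x : ℂ) ^ j - (ω : ℂ) ^ j) / ((ω : ℂ) - x))‖ ≤
      ‖α j‖ * R ^ j * (R - |ω|)⁻¹ := fun x hx j => by
    rw [norm_mul, mul_assoc]
    exact mul_le_mul_of_nonneg_left (norm_pow_sub_pow_div_le (abs_le.2 hx) hR j) (norm_nonneg _)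
  have hqf : IntegrableOn (q f) (Icc (-R) R) :=
    integrableOn_sign_mul_div hν.2 hR0.le (hmeas _ h.continuousOn)
      fun x hx => (hterm x hx).norm_le_of_bounded hb.hasSum (hnorm x hx)
  have hsum : HasSum (fun j => ∫ x in Icc (-R) R, α j * q (fun x => (x : ℂ) ^ j) x)
      (∫ x in Icc (-R) R, q f x) := by
    refine hasSum_integral_of_dominated_convergence
      (fun j x => ‖α j‖ * R ^ j * (R - |ω|)⁻¹ * |x| ^ (-ν))
      (fun j => ((hqj j).const_mul (α j)).aestronglyMeasurable) (fun j => ?_)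
      (ae_of_all _ fun x => hb.mul_right _) ?_ ?_
    · filter_upwards [ae_restrict_mem measurableSet_Icc] with x hx
      have e : α j * q (fun x => (x : ℂ) ^ j) x = (Real.sign x : ℂ) *
          (α j * (((x : ℂ) ^ j - (ω : ℂ) ^ j) / ((ω : ℂ) - x))) / ((|x| ^ ν : ℝ) : ℂ) := by
        simp only [hq]
        ring
      have h0 : 0 ≤ |x| ^ ν := Real.rpow_nonneg (abs_nonneg x) ν
      rw [e, norm_div, norm_mul, Complex.norm_real, Complex.norm_real, Real.norm_eq_abs,
        Real.norm_of_nonneg h0, Real.rpow_neg (abs_nonneg x), div_eq_mul_inv]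
      refine mul_le_mul_of_nonneg_right ?_ (inv_nonneg.2 h0)
      refine (mul_le_of_le_one_left (norm_nonneg _) (abs_sign_le_one x)).trans (hnorm x hx j)
    · simp only [tsum_mul_right]
      exact (integrableOn_abs_rpow_neg hν.2 hR0.le).const_mul _
    · filter_upwards [ae_restrict_mem measurableSet_Icc] with x hx
      refine (((hterm x hx).mul_left (Real.sign x : ℂ)).div_const _).congr_fun fun j => ?_
      simp only [hq]
      ring
  have hval : ∫ x in Icc (-R) R, q f x = -T + f ω * S 0 := by
    refine hsum.unique ?_
    refine (hT1.neg.add (hfω.mul_right (S 0))).congr_fun fun j => ?_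
    rw [integral_const_mul, hqjv]
    ring
  have hfin := (hasPVOn_of_integrableOn (ω := ω) hqf).add ((hpv 0).const_mul (f ω))
  rw [hval] at hfin
  simp only [pow_zero] at hfin
  convert hfin.congr fun x _ _ => ?_ using 1
  · ring
  · rw [hqpv]
    ring

/-! ### Finite-part moments -/

/-- The integrand `((-1) ^ k f(-x) + f(x)) / x ^ (k + ν + 1)` of the `k`-th moment. -/
noncomputable def momentIntegrand (ν : ℝ) (f : ℝ → ℂ) (k : ℕ) (x : ℝ) : ℂ :=
  ((-1) ^ k * f (-x) + f x) / ((x ^ ((k : ℝ) + ν + 1) : ℝ) : ℂ)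

/-- The non-integrable part at `0` of the `k`-th moment integrand of a function with Taylor
coefficients `α`. -/
noncomputable def singularPart (ν : ℝ) (α : ℕ → ℂ) (k : ℕ) (x : ℝ) : ℂ :=
  ∑ j ∈ Finset.range (k + 1),
    α j * ((1 + (-1) ^ (k + j)) * ((x ^ ((j : ℝ) - k - ν - 1) : ℝ) : ℂ))

/-- The primitive of `singularPart` that has no constant term. -/
noncomputable def singularPrimitive (ν : ℝ) (α : ℕ → ℂ) (k : ℕ) (x : ℝ) : ℂ :=
  ∑ j ∈ Finset.range (k + 1), α j * powerMoment ν x j k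

/-- The explicit value of the finite part of the `k`-th moment over `[0, b]`. -/
noncomputable def finitePartMoment (ν : ℝ) (α : ℕ → ℂ) (f : ℝ → ℂ) (k : ℕ) (b : ℝ) : ℂ :=
  (∫ x in (0 : ℝ)..b, (momentIntegrand ν f k x - singularPart ν α k x)) +
    singularPrimitive ν α k b

lemma intervalIntegrable_ofReal {g : ℝ → ℝ} {c d : ℝ} (h : IntervalIntegrable g volume c d) :
    IntervalIntegrable (fun x => (g x : ℂ)) volume c d :=
  ⟨h.1.ofReal, h.2.ofReal⟩

lemma hasSum_momentIntegrand {ν R : ℝ} {α : ℕ → ℂ} {f : ℝ → ℂ}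
    (h : HasExpansionOn α f R) (k : ℕ) {x : ℝ} (hx : x ∈ Ioc 0 R) :
    HasSum (fun j : ℕ => α j * ((1 + (-1) ^ (k + j)) * ((x ^ ((j : ℝ) - k - ν - 1) : ℝ) : ℂ)))
      (momentIntegrand ν f k x) := by
  have h1 := h.2 x (by rw [abs_of_pos hx.1]; exact hx.2)
  have h2 := h.2 (-x) (by rw [abs_neg, abs_of_pos hx.1]; exact hx.2)
  refine (((h2.mul_left ((-1) ^ k)).add h1).div_const _).congr_fun fun j => ?_
  rw [show (j : ℝ) - k - ν - 1 = -(k + ν + 1) + j by ring, Real.rpow_add_natCast hx.1.ne',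
    Real.rpow_neg hx.1.le]
  push_cast
  rw [neg_pow (x : ℂ), pow_add]
  ring

/-- Terms with `j > k` have exponent above `-1` and are integrated termwise from `0`. Terms with `j
≤ k` enter through their primitives at `R`. Both give `α j * powerMoment ν R j k`. -/
lemma finitePartMoment_of_expansion {ν R : ℝ} (hν : ν ∈ Ioo (0 : ℝ) 1) (hR : 0 < R)
    {α : ℕ → ℂ} {f : ℝ → ℂ} (h : HasExpansionOn α f R) (k : ℕ) :
    IntervalIntegrable (fun x => momentIntegrand ν f k x - singularPart ν α k x) volume 0 R ∧
    finitePartMoment ν α f k R = ∑' j, α j * powerMoment ν R j k := by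
  set G : ℕ → ℝ → ℂ := fun j x =>
    α j * ((1 + (-1) ^ (k + j)) * ((x ^ ((j : ℝ) - k - ν - 1) : ℝ) : ℂ)) with hG
  have hsum : ∀ x ∈ Ioc 0 R, HasSum (fun n => G (n + (k + 1)) x)
      (momentIntegrand ν f k x - singularPart ν α k x) := fun x hx =>
    (hasSum_nat_add_iff' (k + 1)).2 (hasSum_momentIntegrand h k hx)
  have hexp : ∀ n : ℕ, -1 < (((n + (k + 1) : ℕ) : ℝ) - k - ν - 1) := fun n => by
    have : (0 : ℝ) ≤ n := n.cast_nonneg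
    push_cast
    linarith [hν.2]
  have hGi : ∀ n, IntervalIntegrable (G (n + (k + 1))) volume 0 R := fun n => by
    refine IntervalIntegrable.const_mul (IntervalIntegrable.const_mul ?_ _) _
    exact intervalIntegrable_ofReal (intervalIntegral.intervalIntegrable_rpow' (hexp n))
  have hGv : ∀ n, ∫ x in (0 : ℝ)..R, G (n + (k + 1)) x =
      α (n + (k + 1)) * powerMoment ν R (n + (k + 1)) k := fun n => by
    have hne : (((n + (k + 1) : ℕ) : ℝ) - k - ν - 1) + 1 ≠ 0 := by linarith [hexp n]
    simp only [hG]
    rw [intervalIntegral.integral_const_mul, intervalIntegral.integral_const_mul,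
      intervalIntegral.integral_ofReal, integral_rpow (Or.inl (hexp n)), Real.zero_rpow hne,
      sub_zero, powerMoment, sub_add_cancel]
  -- This is `2 ‖α (n + k + 1)‖ R ^ n`, written so that its summability is a tail of that of `‖α n‖
  -- R ^ n`.
  set B : ℕ → ℝ := fun n => ‖α (n + (k + 1))‖ * R ^ (n + (k + 1)) * (2 * (R ^ (k + 1))⁻¹) with hB
  have hBs : Summable B := ((summable_nat_add_iff (k + 1)).2 h.1).mul_right _
  have hle : ∀ n, ∀ x ∈ Ioc 0 R, ‖G (n + (k + 1)) x‖ ≤ B n * x ^ (-ν) := fun n x hx => by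
    have hx0 : 0 < x := hx.1
    have e : x ^ (((n + (k + 1) : ℕ) : ℝ) - k - ν - 1) = x ^ n * x ^ (-ν) := by
      rw [show (((n + (k + 1) : ℕ) : ℝ) - k - ν - 1) = -ν + n by push_cast; ring,
        Real.rpow_add_natCast hx0.ne', mul_comm]
    simp only [hG, hB]
    rw [e, norm_mul, norm_mul, Complex.norm_real, Real.norm_of_nonneg (by positivity)]
    calc ‖α (n + (k + 1))‖ * (‖(1 : ℂ) + (-1) ^ (k + (n + (k + 1)))‖ * (x ^ n * x ^ (-ν)))
        ≤ ‖α (n + (k + 1))‖ * (2 * (R ^ n * x ^ (-ν))) := by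
          gcongr
          · exact norm_one_add_neg_one_pow_le _
          · exact hx.2
      _ = _ := by
          rw [pow_add]
          field_simp
  have hdom : IntervalIntegrable (fun x : ℝ => (∑' n, B n) * x ^ (-ν)) volume 0 R :=
    (intervalIntegral.intervalIntegrable_rpow' (by linarith [hν.2])).const_mul _
  have hint : IntervalIntegrable (fun x => momentIntegrand ν f k x - singularPart ν α k x)
      volume 0 R := by
    rw [intervalIntegrable_iff_integrableOn_Ioc_of_le hR.le] at hdom ⊢
    refine Integrable.mono' hdom ?_ ?_
    · refine aestronglyMeasurable_of_tendsto_ae (u := atTop)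
        (f := fun N x => ∑ n ∈ Finset.range N, G (n + (k + 1)) x) (fun N => ?_) ?_
      · exact Finset.aestronglyMeasurable_fun_sum _ fun n _ => (hGi n).1.aestronglyMeasurable
      · filter_upwards [ae_restrict_mem measurableSet_Ioc] with x hx
        exact (hsum x hx).tendsto_sum_nat
    · filter_upwards [ae_restrict_mem measurableSet_Ioc] with x hx
      exact (hsum x hx).norm_le_of_bounded (hBs.hasSum.mul_right _) fun n => hle n x hx
  refine ⟨hint, ?_⟩
  have hI : HasSum (fun n => ∫ x in (0 : ℝ)..R, G (n + (k + 1)) x)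
      (∫ x in (0 : ℝ)..R, (momentIntegrand ν f k x - singularPart ν α k x)) := by
    refine intervalIntegral.hasSum_integral_of_dominated_convergence
      (fun n x => B n * x ^ (-ν)) (fun n => ?_) (fun n => ?_) ?_ ?_ ?_
    · rw [uIoc_of_le hR.le]
      exact (hGi n).1.aestronglyMeasurable
    · rw [uIoc_of_le hR.le]
      exact ae_of_all _ fun x hx => hle n x hx
    · exact ae_of_all _ fun x _ => hBs.mul_right _
    · simpa only [tsum_mul_right] using hdom
    · rw [uIoc_of_le hR.le]
      exact ae_of_all _ fun x hx => hsum x hx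
  simp only [hGv] at hI
  rw [finitePartMoment, ← hI.tsum_eq, singularPrimitive, add_comm]
  exact (summable_mul_powerMoment hν hR h.1 k).sum_add_tsum_nat_add (k + 1)

lemma continuousOn_momentIntegrand {ν b : ℝ} {f : ℝ → ℂ} (hf : ContinuousOn f (Icc (-b) b))
    (k : ℕ) : ContinuousOn (momentIntegrand ν f k) (Ioc 0 b) := by
  have h1 : ContinuousOn f (Ioc 0 b) := hf.mono fun x hx => ⟨by linarith [hx.1, hx.2], hx.2⟩
  have h2 : ContinuousOn (fun x => f (-x)) (Ioc 0 b) :=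
    hf.comp continuousOn_neg fun x hx => ⟨by linarith [hx.2], by linarith [hx.1, hx.2]⟩
  refine ((continuousOn_const.mul h2).add h1).div ?_ fun x hx => ?_
  · refine Complex.continuous_ofReal.comp_continuousOn ?_
    exact continuousOn_id.rpow_const fun x hx => Or.inl hx.1.ne'
  · exact_mod_cast (Real.rpow_pos_of_pos hx.1 _).ne'

lemma intervalIntegrable_momentIntegrand {ν b : ℝ} {f : ℝ → ℂ} (hf : ContinuousOn f (Icc (-b) b))
    (k : ℕ) {c d : ℝ} (hc : c ∈ Ioc 0 b) (hd : d ∈ Ioc 0 b) :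
    IntervalIntegrable (momentIntegrand ν f k) volume c d :=
  ((continuousOn_momentIntegrand hf k).mono
    (ordConnected_Ioc.uIcc_subset hc hd)).intervalIntegrable

lemma integral_singularPart {ν : ℝ} (hν : ν ∈ Ioo (0 : ℝ) 1) (α : ℕ → ℂ) (k : ℕ) {c d : ℝ}
    (hc : 0 < c) (hd : 0 < d) :
    IntervalIntegrable (singularPart ν α k) volume c d ∧
    ∫ x in c..d, singularPart ν α k x = singularPrimitive ν α k d - singularPrimitive ν α k c := by
  have h0 : (0 : ℝ) ∉ uIcc c d := fun h => absurd h.1 (not_le.2 (lt_min hc hd))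
  have hi : ∀ j : ℕ, IntervalIntegrable (fun x : ℝ =>
      α j * ((1 + (-1) ^ (k + j)) * ((x ^ ((j : ℝ) - k - ν - 1) : ℝ) : ℂ))) volume c d := fun j =>
    ((intervalIntegrable_ofReal (intervalIntegral.intervalIntegrable_rpow
      (Or.inr h0))).const_mul _).const_mul _
  constructor
  · have e : singularPart ν α k = ∑ j ∈ Finset.range (k + 1), fun x : ℝ =>
        α j * ((1 + (-1) ^ (k + j)) * ((x ^ ((j : ℝ) - k - ν - 1) : ℝ) : ℂ)) := by
      ext x
      simp only [singularPart, Finset.sum_apply]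
    rw [e]
    exact IntervalIntegrable.sum (Finset.range (k + 1)) (fun j _ => hi j)
  · simp only [singularPart, singularPrimitive]
    rw [intervalIntegral.integral_finsetSum fun j _ => hi j, ← Finset.sum_sub_distrib]
    refine Finset.sum_congr rfl fun j _ => ?_
    have hne := natCast_sub_ne hν j k
    rw [intervalIntegral.integral_const_mul, intervalIntegral.integral_const_mul,
      intervalIntegral.integral_ofReal, integral_rpow (Or.inr ⟨fun h => hne (by linarith), h0⟩),
      powerMoment, powerMoment, sub_add_cancel, sub_div]
    push_cast
    ring

lemma finitePartMoment_extend {ν : ℝ} (hν : ν ∈ Ioo (0 : ℝ) 1) {α : ℕ → ℂ} {f : ℝ → ℂ} {k : ℕ}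
    {R b : ℝ} (hR : 0 < R) (hRb : R ≤ b) (hf : ContinuousOn f (Icc (-b) b))
    (h : IntervalIntegrable (fun x => momentIntegrand ν f k x - singularPart ν α k x)
      volume 0 R) :
    IntervalIntegrable (fun x => momentIntegrand ν f k x - singularPart ν α k x) volume 0 b ∧
    finitePartMoment ν α f k b =
      finitePartMoment ν α f k R + ∫ x in R..b, momentIntegrand ν f k x := by
  have h1 := intervalIntegrable_momentIntegrand (ν := ν) hf k (c := R) (d := b) ⟨hR, hRb⟩
    ⟨hR.trans_le hRb, le_rfl⟩
  obtain ⟨h2, h3⟩ := integral_singularPart hν α k hR (hR.trans_le hRb)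
  refine ⟨h.trans (h1.sub h2), ?_⟩
  rw [finitePartMoment, finitePartMoment,
    ← intervalIntegral.integral_add_adjacent_intervals h (h1.sub h2),
    intervalIntegral.integral_sub h1 h2, h3]
  ring

lemma singularPrimitive_mem_divergingParts {ν : ℝ} (hν : ν ∈ Ioo (0 : ℝ) 1) (α : ℕ → ℂ) (k : ℕ) :
    (fun ε => singularPrimitive ν α k ε) ∈ divergingParts := by
  have : (fun ε => singularPrimitive ν α k ε) = ∑ j ∈ Finset.range (k + 1),
      (α j * ((1 + (-1) ^ (k + j)) * (((j : ℝ) - k - ν : ℝ) : ℂ)⁻¹)) •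
        (fun ε : ℝ => ((ε ^ (-((k : ℝ) + ν - j)) * Real.log ε ^ 0 : ℝ) : ℂ)) := by
    ext ε
    simp only [singularPrimitive, powerMoment, Finset.sum_apply, Pi.smul_apply, smul_eq_mul]
    refine Finset.sum_congr rfl fun j _ => ?_
    rw [show -((k : ℝ) + ν - j) = j - k - ν by ring, pow_zero, mul_one]
    push_cast
    ring
  rw [this]
  refine Submodule.sum_mem _ fun j hj => Submodule.smul_mem _ _ (Submodule.subset_span ?_)
  have hj' : (j : ℝ) ≤ k := by
    exact_mod_cast Nat.lt_succ_iff.1 (Finset.mem_range.1 hj)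
  exact ⟨k + ν - j, 0, by linarith [hν.1], Or.inl (by linarith [hν.1]), rfl⟩

/-- The integral of the singular part over `[ε, b]` is its primitive at `b`, which is kept, minus
its primitive at `ε`, which is a pure combination of diverging powers. The regularised integral is
continuous in `ε` down to `0`. -/
lemma hasFinitePartOn_momentIntegrand {ν : ℝ} (hν : ν ∈ Ioo (0 : ℝ) 1) {α : ℕ → ℂ} {f : ℝ → ℂ}
    {k : ℕ} {b : ℝ} (hb : 0 < b) (hf : ContinuousOn f (Icc (-b) b))
    (h : IntervalIntegrable (fun x => momentIntegrand ν f k x - singularPart ν α k x)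
      volume 0 b) :
    HasFinitePartOn (momentIntegrand ν f k) b (finitePartMoment ν α f k b) := by
  refine ⟨fun ε hε => intervalIntegrable_momentIntegrand hf k ⟨hε.1, hε.2.le⟩ ⟨hb, le_rfl⟩,
    -(fun ε => singularPrimitive ν α k ε),
    Submodule.neg_mem _ (singularPrimitive_mem_divergingParts hν α k), ?_⟩
  have hcont : Tendsto (fun ε => ∫ x in ε..b, (momentIntegrand ν f k x - singularPart ν α k x))
      (𝓝[>] 0) (𝓝 (∫ x in (0 : ℝ)..b, (momentIntegrand ν f k x - singularPart ν α k x))) := by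
    have hc := intervalIntegral.continuousOn_primitive_interval_left
      (f := fun x => momentIntegrand ν f k x - singularPart ν α k x) (μ := volume)
      (a := 0) (b := b) (by
        rw [uIcc_of_le hb.le, integrableOn_Icc_iff_integrableOn_Ioc]
        exact h.1)
    have hc0 := hc 0 left_mem_uIcc
    refine hc0.tendsto.mono_left ?_
    rw [uIcc_of_le hb.le]
    exact nhdsWithin_le_of_mem (Icc_mem_nhdsGT hb)
  refine (hcont.add_const (singularPrimitive ν α k b)).congr' ?_
  filter_upwards [Ioo_mem_nhdsGT hb] with ε hε
  have h1 := intervalIntegrable_momentIntegrand (ν := ν) hf k (c := ε) (d := b) ⟨hε.1, hε.2.le⟩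
    ⟨hb, le_rfl⟩
  obtain ⟨h2, h3⟩ := integral_singularPart hν α k hε.1 hb
  rw [intervalIntegral.integral_sub h1 h2, h3, Pi.neg_apply]
  ring

/-! ### Folding the integrand about the origin -/

lemma hilbertIntegrand_add_neg (ν : ℝ) (f : ℝ → ℂ) {ω x : ℝ} (hx : 0 < x) :
    hilbertIntegrand ν f ω x + hilbertIntegrand ν f ω (-x) =
      (f x / ((ω : ℂ) - x) - f (-x) / ((ω : ℂ) + x)) / ((x ^ ν : ℝ) : ℂ) := by
  rw [hilbertIntegrand, hilbertIntegrand, abs_neg, abs_of_pos hx, Real.sign_of_pos hx,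
    Real.sign_of_neg (by linarith)]
  push_cast
  rw [sub_neg_eq_add, mul_comm, div_mul_eq_div_div, mul_comm (((x : ℝ) ^ ν : ℝ) : ℂ),
    div_mul_eq_div_div]
  ring

/-- Geometric series in `ω / x` for the half-line `x > 0` and in `-ω / x` for its mirror image. The
latter produces the sign `(-1) ^ k` in the moments. -/
lemma hasSum_hilbertIntegrand_add_neg (ν : ℝ) (f : ℝ → ℂ) {ω x : ℝ} (hx : |ω| < x) :
    HasSum (fun k : ℕ => (ω : ℂ) ^ k * momentIntegrand ν f k x)
      (-(hilbertIntegrand ν f ω x + hilbertIntegrand ν f ω (-x))) := by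
  have hx0 : 0 < x := (abs_nonneg ω).trans_lt hx
  have hxc : (x : ℂ) ≠ 0 := by exact_mod_cast hx0.ne'
  have hxν : ((x ^ ν : ℝ) : ℂ) ≠ 0 := by exact_mod_cast (Real.rpow_pos_of_pos hx0 ν).ne'
  have hlt : ‖(ω : ℂ) / x‖ < 1 := by
    rw [norm_div, Complex.norm_real, Complex.norm_real, Real.norm_eq_abs, Real.norm_of_nonneg hx0.le]
    exact (div_lt_one hx0).2 hx
  have hlt' : ‖-((ω : ℂ) / x)‖ < 1 := by rwa [norm_neg]
  obtain ⟨a1, a2⟩ := abs_lt.1 hx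
  have e1 : (ω : ℂ) - x ≠ 0 := by
    rw [← Complex.ofReal_sub]
    exact_mod_cast (by linarith : ω - x < 0).ne
  have e2 : (ω : ℂ) + x ≠ 0 := by
    rw [← Complex.ofReal_add]
    exact_mod_cast (by linarith : 0 < ω + x).ne'
  have h1 := ((hasSum_geometric_of_norm_lt_one hlt').mul_left (f (-x))).add
    ((hasSum_geometric_of_norm_lt_one hlt).mul_left (f x))
  have h2 := h1.div_const (((x ^ ν : ℝ) : ℂ) * x)
  have hv : (f (-x) * (1 - -((ω : ℂ) / x))⁻¹ + f x * (1 - (ω : ℂ) / x)⁻¹) /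
      (((x ^ ν : ℝ) : ℂ) * x) = -(hilbertIntegrand ν f ω x + hilbertIntegrand ν f ω (-x)) := by
    rw [hilbertIntegrand_add_neg ν f hx0, sub_neg_eq_add, one_add_div hxc, one_sub_div hxc,
      inv_div, inv_div, add_comm (x : ℂ), show (x : ℂ) - ω = -(ω - x) by ring]
    field_simp
    ring
  rw [hv] at h2
  refine h2.congr_fun fun k => ?_
  rw [momentIntegrand, show (k : ℝ) + ν + 1 = ν + ((k + 1 : ℕ) : ℝ) by push_cast; ring,
    Real.rpow_add_natCast hx0.ne', neg_pow ((ω : ℂ) / x), div_pow]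
  push_cast
  field_simp
  ring

/-! ### Bounded intervals -/

lemma continuousOn_hilbertIntegrand {ν ω : ℝ} {f : ℝ → ℂ} {s : Set ℝ} (hf : ContinuousOn f s) :
    ContinuousOn (hilbertIntegrand ν f ω) (s \ {0, ω}) := by
  have hsign : ContinuousOn (fun x => (Real.sign x : ℂ)) (s \ {0, ω}) := by
    intro x hx
    refine ContinuousAt.continuousWithinAt ?_
    have hx0 : x ≠ 0 := fun h => hx.2 (by simp [h])
    have : Real.sign =ᶠ[𝓝 x] fun _ => Real.sign x := by
      rcases lt_or_gt_of_ne hx0 with h | h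
      · filter_upwards [Iio_mem_nhds h] with y hy
        rw [Real.sign_of_neg h, Real.sign_of_neg hy]
      · filter_upwards [Ioi_mem_nhds h] with y hy
        rw [Real.sign_of_pos h, Real.sign_of_pos hy]
    exact (Complex.continuous_ofReal.continuousAt).comp
      (continuousAt_const.congr this.symm)
  refine (hsign.mul (hf.mono sdiff_subset)).div ?_ fun x hx => ?_
  · refine ContinuousOn.mul ?_ (by fun_prop)
    refine Complex.continuous_ofReal.comp_continuousOn ?_
    refine continuous_abs.continuousOn.rpow_const fun x hx => Or.inl (abs_ne_zero.2 fun h => ?_)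
    exact hx.2 (by simp [h])
  · have hx0 : x ≠ 0 := fun h => hx.2 (by simp [h])
    refine mul_ne_zero ?_ ?_
    · exact_mod_cast (Real.rpow_pos_of_pos (abs_pos.2 hx0) ν).ne'
    · rw [sub_ne_zero]
      exact_mod_cast fun h => hx.2 (by simp [h])

lemma integral_hilbertIntegrand_outer {ν b R ω : ℝ} {f : ℝ → ℂ} (hωR : |ω| < R) (hRb : R ≤ b)
    (hf : ContinuousOn f (Icc (-b) b)) :
    IntegrableOn (hilbertIntegrand ν f ω) (Icc (-b) b \ Icc (-R) R) ∧
    IntervalIntegrable (fun x => hilbertIntegrand ν f ω x + hilbertIntegrand ν f ω (-x))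
      volume R b ∧
    ∫ x in Icc (-b) b \ Icc (-R) R, hilbertIntegrand ν f ω x =
      ∫ x in R..b, (hilbertIntegrand ν f ω x + hilbertIntegrand ν f ω (-x)) := by
  have hR0 : 0 < R := (abs_nonneg ω).trans_lt hωR
  obtain ⟨a1, a2⟩ := abs_lt.1 hωR
  have hc := continuousOn_hilbertIntegrand (ν := ν) (ω := ω) hf
  have i1 : IntervalIntegrable (hilbertIntegrand ν f ω) volume R b := by
    refine (hc.mono ?_).intervalIntegrable
    rw [uIcc_of_le hRb]
    rintro x ⟨h1, h2⟩
    refine ⟨⟨by linarith, h2⟩, ?_⟩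
    rintro (h | h) <;> [skip; rw [mem_singleton_iff] at h] <;> linarith
  have i2 : IntervalIntegrable (hilbertIntegrand ν f ω) volume (-b) (-R) := by
    refine (hc.mono ?_).intervalIntegrable
    rw [uIcc_of_le (by linarith)]
    rintro x ⟨h1, h2⟩
    refine ⟨⟨h1, by linarith⟩, ?_⟩
    rintro (h | h) <;> [skip; rw [mem_singleton_iff] at h] <;> linarith
  have i3 := ((IntervalIntegrable.iff_comp_neg (f := hilbertIntegrand ν f ω)
    (a := -b) (b := -R)).1 i2).symm
  rw [neg_neg, neg_neg] at i3
  have hs : Icc (-b) b \ Icc (-R) R = Ico (-b) (-R) ∪ Ioc R b := by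
    ext x
    simp only [Set.mem_sdiff, mem_Icc, mem_union, mem_Ico, mem_Ioc, not_and_or, not_le]
    constructor
    · rintro ⟨⟨h1, h2⟩, h3 | h3⟩
      · exact Or.inl ⟨h1, h3⟩
      · exact Or.inr ⟨h3, h2⟩
    · rintro (⟨h1, h2⟩ | ⟨h1, h2⟩)
      · exact ⟨⟨h1, by linarith⟩, Or.inl h2⟩
      · exact ⟨⟨by linarith, h2⟩, Or.inr h1⟩
  have j2 : IntegrableOn (hilbertIntegrand ν f ω) (Ico (-b) (-R)) := by
    rw [integrableOn_Ico_iff_integrableOn_Ioo, ← integrableOn_Ioc_iff_integrableOn_Ioo]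
    exact i2.1
  refine ⟨?_, i1.add i3, ?_⟩
  · rw [hs]
    exact j2.union i1.1
  · rw [hs, setIntegral_union (disjoint_left.2 fun x hx hx' => by linarith [hx.2, hx'.1])
      measurableSet_Ioc j2 i1.1, intervalIntegral.integral_add i1 i3,
      intervalIntegral.integral_comp_neg, integral_Ico_eq_integral_Ioo,
      ← integral_Ioc_eq_integral_Ioo, ← intervalIntegral.integral_of_le (by linarith),
      ← intervalIntegral.integral_of_le hRb, add_comm]

lemma hasSum_integral_momentIntegrand {ν b R ω : ℝ} {f : ℝ → ℂ} (hν : ν ∈ Ioo (0 : ℝ) 1)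
    (hωR : |ω| < R) (hRb : R ≤ b) (hf : ContinuousOn f (Icc (-b) b)) :
    HasSum (fun k : ℕ => (ω : ℂ) ^ k * ∫ x in R..b, momentIntegrand ν f k x)
      (-∫ x in R..b, (hilbertIntegrand ν f ω x + hilbertIntegrand ν f ω (-x))) := by
  have hR0 : 0 < R := (abs_nonneg ω).trans_lt hωR
  obtain ⟨C, hC⟩ := isCompact_Icc.exists_bound_of_continuousOn hf
  have hi : ∀ k, IntervalIntegrable (momentIntegrand ν f k) volume R b := fun k =>
    intervalIntegrable_momentIntegrand hf k ⟨hR0, hRb⟩ ⟨hR0.trans_le hRb, le_rfl⟩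
  have hg : Summable fun k : ℕ => (2 * C * (R ^ (ν + 1))⁻¹) * (|ω| / R) ^ k :=
    (summable_geometric_of_lt_one (by positivity) ((div_lt_one hR0).2 hωR)).mul_left _
  have h := intervalIntegral.hasSum_integral_of_dominated_convergence (μ := volume) (a := R)
    (b := b) (F := fun (k : ℕ) x => (ω : ℂ) ^ k * momentIntegrand ν f k x)
    (f := fun x => -(hilbertIntegrand ν f ω x + hilbertIntegrand ν f ω (-x)))
    (fun k _ => (2 * C * (R ^ (ν + 1))⁻¹) * (|ω| / R) ^ k) (fun k => ?_) (fun k => ?_)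
    (ae_of_all _ fun _ _ => hg) intervalIntegrable_const ?_
  · simpa only [intervalIntegral.integral_const_mul, intervalIntegral.integral_neg] using h
  · rw [uIoc_of_le hRb]
    exact ((hi k).const_mul _).1.aestronglyMeasurable
  · rw [uIoc_of_le hRb]
    refine ae_of_all _ fun x hx => ?_
    have hx0 : 0 < x := hR0.trans hx.1
    have hn : ‖(-1) ^ k * f (-x) + f x‖ ≤ 2 * C := by
      refine (norm_add_le _ _).trans ?_
      rw [norm_mul, norm_pow, norm_neg, norm_one, one_pow, one_mul, two_mul]
      exact add_le_add (hC _ ⟨by linarith [hx.2], by linarith [hx.2]⟩)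
        (hC _ ⟨by linarith [hx.2], hx.2⟩)
    have hC0 : 0 ≤ C := by linarith [(norm_nonneg _).trans hn]
    rw [momentIntegrand, norm_mul, norm_pow, norm_div, Complex.norm_real, Complex.norm_real,
      Real.norm_eq_abs, Real.norm_of_nonneg (by positivity)]
    have hle : R ^ (ν + 1) * R ^ k ≤ x ^ ((k : ℝ) + ν + 1) := by
      rw [← Real.rpow_add_natCast hR0.ne', show (k : ℝ) + ν + 1 = ν + 1 + k by ring]
      exact Real.rpow_le_rpow hR0.le hx.1.le (by
        have : (0 : ℝ) ≤ k := k.cast_nonneg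
        linarith [hν.1])
    calc |ω| ^ k * (‖(-1) ^ k * f (-x) + f x‖ / x ^ ((k : ℝ) + ν + 1))
        ≤ |ω| ^ k * (2 * C / (R ^ (ν + 1) * R ^ k)) := by gcongr
      _ = _ := by
        rw [div_pow]
        field_simp
  · rw [uIoc_of_le hRb]
    exact ae_of_all _ fun x hx => hasSum_hilbertIntegrand_add_neg ν f (hωR.trans hx.1)

/-- Passing from `R` to `b` changes both sides by the same integral over `R < |x| ≤ b`, where only
continuity of `f` is needed. The interval may thus reach beyond the disc of convergence. -/
lemma HasExpansionOn.hasPVOn_extend {ν b R ω : ℝ} (hν : ν ∈ Ioo (0 : ℝ) 1) (hω : ω ≠ 0)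
    (hωR : |ω| < R) (hRb : R ≤ b) {α : ℕ → ℂ} {f : ℝ → ℂ} (h : HasExpansionOn α f R)
    (hf : ContinuousOn f (Icc (-b) b)) :
    ∃ S : ℂ, HasSum (fun k : ℕ => (ω : ℂ) ^ k * finitePartMoment ν α f k b) S ∧
    HasPVOn (hilbertIntegrand ν f ω) ω b
      (-S - ((Real.pi * Real.cot (Real.pi * ν / 2) : ℝ) : ℂ) *
        (f ω / ((|ω| ^ ν : ℝ) : ℂ))) := by
  have hR0 : 0 < R := (abs_nonneg ω).trans_lt hωR
  obtain ⟨S, hS, hpv⟩ := h.hasPVOn hν hω hωR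
  obtain ⟨o1, _, o3⟩ := integral_hilbertIntegrand_outer (ν := ν) hωR hRb hf
  have hout := hasSum_integral_momentIntegrand hν hωR hRb hf
  refine ⟨_, (hS.add hout).congr_fun fun k => ?_, ?_⟩
  · obtain ⟨m1, m2⟩ := finitePartMoment_of_expansion hν hR0 h k
    rw [(finitePartMoment_extend hν hR0 hRb hf m1).2, m2]
    ring
  · have := hpv.extend hωR hRb o1
    rw [o3] at this
    convert this using 1
    ring

/-! ### Improper integrals -/

lemma integral_mul_rpow_neg {φ : ℝ → ℂ} {c R : ℝ} (hc : 0 ≤ c) (hcR : c < R)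
    (hφ : ContinuousOn φ (Ioi c)) (n : ℕ) {b : ℝ} (hb : R ≤ b) :
    ∫ x in R..b, φ x * ((x ^ (-(n : ℝ)) : ℝ) : ℂ) =
      ((b ^ (-(n : ℝ)) : ℝ) : ℂ) * (∫ x in R..b, φ x) +
      ∫ x in R..b, ((n * x ^ (-(n : ℝ) - 1) : ℝ) : ℂ) * ∫ y in R..x, φ y := by
  have hsub : ∀ x ∈ uIcc R b, c < x := fun x hx => by
    rw [uIcc_of_le hb] at hx
    exact hcR.trans_le hx.1
  have hint : ∀ x, c < x → IntervalIntegrable φ volume R x := fun x hx =>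
    (hφ.mono (ordConnected_Ioi.uIcc_subset hcR hx)).intervalIntegrable
  have hd1 : ∀ x ∈ uIcc R b, HasDerivAt (fun x => ∫ y in R..x, φ y) (φ x) x := fun x hx =>
    intervalIntegral.integral_hasDerivAt_right (hint x (hsub x hx))
      (hφ.stronglyMeasurableAtFilter isOpen_Ioi _ (hsub x hx))
      (hφ.continuousAt (Ioi_mem_nhds (hsub x hx)))
  have hd2 : ∀ x ∈ uIcc R b, HasDerivAt (fun x : ℝ => ((x ^ (-(n : ℝ)) : ℝ) : ℂ))
      ((-(n : ℝ) * x ^ (-(n : ℝ) - 1) : ℝ) : ℂ) x := fun x hx =>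
    (Real.hasDerivAt_rpow_const (Or.inl (hc.trans_lt (hsub x hx)).ne')).ofReal_comp
  have hi2 : IntervalIntegrable (fun x : ℝ => ((-(n : ℝ) * x ^ (-(n : ℝ) - 1) : ℝ) : ℂ))
      volume R b := by
    refine ContinuousOn.intervalIntegrable ?_
    refine Complex.continuous_ofReal.comp_continuousOn (continuousOn_const.mul ?_)
    exact continuousOn_id.rpow_const fun x hx => Or.inl (hc.trans_lt (hsub x hx)).ne'
  have := intervalIntegral.integral_mul_deriv_eq_deriv_mul hd2 hd1 hi2
    (hint b (hcR.trans_le hb))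
  simp only [mul_comm (φ _)]
  rw [this, intervalIntegral.integral_same, mul_zero, sub_zero, sub_eq_add_neg,
    ← intervalIntegral.integral_neg]
  congr 2
  ext x
  push_cast
  ring

/-- Only the partial integrals of `φ` are bounded, since convergence may be conditional. After
integration by parts the boundary term `M b ^ (-n)` and the remaining `M (R ^ (-n) - b ^ (-n))` add
up exactly. -/
lemma norm_integral_mul_rpow_neg_le {φ : ℝ → ℂ} {c R M : ℝ} (hc : 0 ≤ c) (hcR : c < R)
    (hφ : ContinuousOn φ (Ioi c)) (hM : ∀ b, R ≤ b → ‖∫ x in R..b, φ x‖ ≤ M) (n : ℕ)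
    {b : ℝ} (hb : R ≤ b) :
    ‖∫ x in R..b, φ x * ((x ^ (-(n : ℝ)) : ℝ) : ℂ)‖ ≤ M * R ^ (-(n : ℝ)) := by
  have hR0 : 0 < R := hc.trans_lt hcR
  have hb0 : 0 < b := hR0.trans_le hb
  have h0 : (0 : ℝ) ∉ uIcc R b := by
    rw [uIcc_of_le hb]
    exact fun h => absurd h.1 (not_le.2 hR0)
  have hI : ∫ x in R..b, M * (n * x ^ (-(n : ℝ) - 1)) =
      M * (R ^ (-(n : ℝ)) - b ^ (-(n : ℝ))) := by
    rcases Nat.eq_zero_or_pos n with rfl | hn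
    · simp
    have hn' : (0 : ℝ) < n := by exact_mod_cast hn
    rw [intervalIntegral.integral_const_mul, intervalIntegral.integral_const_mul,
      integral_rpow (Or.inr ⟨by linarith, h0⟩), sub_add_cancel]
    field_simp
    ring
  rw [integral_mul_rpow_neg hc hcR hφ n hb]
  have h1 : ‖((b ^ (-(n : ℝ)) : ℝ) : ℂ) * (∫ x in R..b, φ x)‖ ≤ b ^ (-(n : ℝ)) * M := by
    rw [norm_mul, Complex.norm_real, Real.norm_of_nonneg (by positivity)]
    exact mul_le_mul_of_nonneg_left (hM b hb) (by positivity)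
  have h2 : ‖∫ x in R..b, ((n * x ^ (-(n : ℝ) - 1) : ℝ) : ℂ) * ∫ y in R..x, φ y‖ ≤
      M * (R ^ (-(n : ℝ)) - b ^ (-(n : ℝ))) := by
    rw [← hI]
    refine intervalIntegral.norm_integral_le_of_norm_le hb (ae_of_all _ fun x hx => ?_) ?_
    · have hx0 : 0 < x := hR0.trans hx.1
      rw [norm_mul, Complex.norm_real, Real.norm_of_nonneg (by positivity), mul_comm]
      exact mul_le_mul_of_nonneg_right (hM x hx.1.le) (by positivity)
    · exact ((intervalIntegral.intervalIntegrable_rpow (Or.inr h0)).const_mul _).const_mul _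
  refine (norm_add_le _ _).trans ((add_le_add h1 h2).trans (le_of_eq ?_))
  ring

lemma exists_bound_integral_of_tendsto {φ : ℝ → ℂ} {c R : ℝ} (hcR : c < R)
    (hφ : ContinuousOn φ (Ioi c)) {L : ℂ}
    (hL : Tendsto (fun b => ∫ x in R..b, φ x) atTop (𝓝 L)) :
    ∃ M, ∀ b, R ≤ b → ‖∫ x in R..b, φ x‖ ≤ M := by
  obtain ⟨B, hB⟩ := eventually_atTop.1 (hL.norm.eventually_le_const (lt_add_one ‖L‖))
  have hint : IntegrableOn φ (uIcc R (max R B)) := by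
    refine ContinuousOn.integrableOn_compact isCompact_uIcc (hφ.mono ?_)
    exact ordConnected_Ioi.uIcc_subset hcR (hcR.trans_le (le_max_left _ _))
  have hcont := intervalIntegral.continuousOn_primitive_interval hint
  obtain ⟨C, hC⟩ := isCompact_uIcc.exists_bound_of_continuousOn hcont
  refine ⟨max C (‖L‖ + 1), fun b hb => ?_⟩
  rcases le_total B b with h | h
  · exact (hB b h).trans (le_max_right _ _)
  · refine (hC b ?_).trans (le_max_left _ _)
    rw [uIcc_of_le (le_max_left _ _)]
    exact ⟨hb, h.trans (le_max_right _ _)⟩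

/-- Abel's test. For `n > 0`, integration by parts yields a vanishing boundary term and an
absolutely convergent integral. -/
lemma tendsto_integral_mul_rpow_neg {φ : ℝ → ℂ} {c R : ℝ} (hc : 0 ≤ c) (hcR : c < R)
    (hφ : ContinuousOn φ (Ioi c)) {L : ℂ}
    (hL : Tendsto (fun b => ∫ x in R..b, φ x) atTop (𝓝 L)) (n : ℕ) :
    ∃ L', Tendsto (fun b => ∫ x in R..b, φ x * ((x ^ (-(n : ℝ)) : ℝ) : ℂ)) atTop (𝓝 L') := by
  rcases Nat.eq_zero_or_pos n with rfl | hn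
  · exact ⟨L, by simpa using hL⟩
  have hn' : (0 : ℝ) < n := by exact_mod_cast hn
  have hR0 : 0 < R := hc.trans_lt hcR
  obtain ⟨M, hM⟩ := exists_bound_integral_of_tendsto hcR hφ hL
  have hpow : IntegrableOn (fun x : ℝ => M * (n * x ^ (-(n : ℝ) - 1))) (Ioi R) :=
    ((integrableOn_Ioi_rpow_of_lt (by linarith) hR0).const_mul _).const_mul _
  have hcont : ContinuousOn (fun x => ∫ y in R..x, φ y) (Ioi R) := fun x hx => by
    have hx' : c < x := hcR.trans hx
    exact (intervalIntegral.integral_hasDerivAt_right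
      (hφ.mono (ordConnected_Ioi.uIcc_subset hcR hx')).intervalIntegrable
      (hφ.stronglyMeasurableAtFilter isOpen_Ioi _ hx')
      (hφ.continuousAt (Ioi_mem_nhds hx'))).continuousAt.continuousWithinAt
  have hint : IntegrableOn (fun x : ℝ => ((n * x ^ (-(n : ℝ) - 1) : ℝ) : ℂ) * ∫ y in R..x, φ y)
      (Ioi R) := by
    refine Integrable.mono' hpow ?_ ?_
    · refine ContinuousOn.aestronglyMeasurable (ContinuousOn.mul ?_ hcont) measurableSet_Ioi
      refine Complex.continuous_ofReal.comp_continuousOn (continuousOn_const.mul ?_)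
      exact continuousOn_id.rpow_const fun x hx => Or.inl (hR0.trans hx).ne'
    · filter_upwards [ae_restrict_mem measurableSet_Ioi] with x hx
      have hx0 : 0 < x := hR0.trans hx
      rw [norm_mul, Complex.norm_real, Real.norm_of_nonneg (by positivity), mul_comm]
      exact mul_le_mul_of_nonneg_right (hM x (le_of_lt hx)) (by positivity)
  have h1 := intervalIntegral_tendsto_integral_Ioi R hint tendsto_id
  have h2 : Tendsto (fun b : ℝ => ((b ^ (-(n : ℝ)) : ℝ) : ℂ)) atTop (𝓝 ((0 : ℝ) : ℂ)) :=
    (Complex.continuous_ofReal.tendsto 0).comp (tendsto_rpow_neg_atTop hn')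
  refine ⟨_, ((h2.mul hL).add h1).congr' ?_⟩
  filter_upwards [eventually_ge_atTop R] with b hb
  exact (integral_mul_rpow_neg hc hcR hφ n hb).symm

/-- The principal values over `[-b, b]` and over a fixed `[-B, B]` differ by the folded integral
over `[B, b]`, so one converges with the other. -/
lemma exists_tendsto_of_hasPV_top {ν ω R : ℝ} {f : ℝ → ℂ} (hf : Continuous f) (hωR : |ω| < R)
    {v : ℂ} (h : HasPV (hilbertIntegrand ν f ω) ω ∞ v) :
    ∃ L, Tendsto (fun b => ∫ x in R..b, (hilbertIntegrand ν f ω x + hilbertIntegrand ν f ω (-x)))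
      atTop (𝓝 L) := by
  obtain ⟨I, hI, hlim⟩ := h.2 rfl
  obtain ⟨B', hB'⟩ := eventually_atTop.1 hI
  set B := max B' R
  have hRB : R ≤ B := le_max_right _ _
  refine ⟨_, ((hlim.sub_const (I B)).const_add (∫ x in R..B, (hilbertIntegrand ν f ω x +
    hilbertIntegrand ν f ω (-x)))).congr' ?_⟩
  filter_upwards [eventually_ge_atTop B] with b hb
  have h1 := hB' b ((le_max_left _ _).trans hb)
  obtain ⟨o1, o2, o3⟩ := integral_hilbertIntegrand_outer (ν := ν) (hωR.trans_le hRB) hb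
    (hf.continuousOn (s := Icc (-b) b))
  have h2 := (hB' B (le_max_left _ _)).extend (hωR.trans_le hRB) hb o1
  obtain ⟨_, p2, _⟩ := integral_hilbertIntegrand_outer (ν := ν) hωR hRB
    (hf.continuousOn (s := Icc (-B) B))
  rw [h1.unique h2, o3, ← intervalIntegral.integral_add_adjacent_intervals p2 o2]
  ring

/-! ### Convergence of the moments at infinity -/

lemma momentIntegrand_add_two_mul (ν : ℝ) (f : ℝ → ℂ) (k i : ℕ) {x : ℝ} (hx : 0 < x) :
    momentIntegrand ν f (k + 2 * i) x =
      momentIntegrand ν f k x * ((x ^ (-((2 * i : ℕ) : ℝ)) : ℝ) : ℂ) := by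
  have h2 : ((x ^ ((k : ℝ) + ν + 1) : ℝ) : ℂ) ≠ 0 := by
    exact_mod_cast (Real.rpow_pos_of_pos hx _).ne'
  rw [momentIntegrand, momentIntegrand, pow_add (-1 : ℂ), pow_mul (-1 : ℂ), neg_one_sq, one_pow,
    mul_one, Real.rpow_neg hx.le, Real.rpow_natCast,
    show ((k + 2 * i : ℕ) : ℝ) + ν + 1 = k + ν + 1 + ((2 * i : ℕ) : ℝ) by push_cast; ring,
    Real.rpow_add_natCast hx.ne']
  push_cast
  field_simp

/-- Adding the folded integrands at `ω` and `-ω` isolates `f x + f (-x)` with the factor `2 x / (ω ^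
2 - x ^ 2)`. Undoing this factor costs only the multipliers `1` and `x ^ (-2)`, both within reach of
Abel's test. -/
lemma momentIntegrand_zero_eq (ν : ℝ) (f : ℝ → ℂ) {ω x : ℝ} (hω : 0 < ω) (hx : ω < x) :
    momentIntegrand ν f 0 x =
      ((ω : ℂ) ^ 2 / 2) * (((hilbertIntegrand ν f ω x + hilbertIntegrand ν f ω (-x)) +
        (hilbertIntegrand ν f (-ω) x + hilbertIntegrand ν f (-ω) (-x))) *
          ((x ^ (-((2 : ℕ) : ℝ)) : ℝ) : ℂ)) +
      (-1 / 2) * ((hilbertIntegrand ν f ω x + hilbertIntegrand ν f ω (-x)) +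
        (hilbertIntegrand ν f (-ω) x + hilbertIntegrand ν f (-ω) (-x))) := by
  have hx0 : 0 < x := hω.trans hx
  have hxc : (x : ℂ) ≠ 0 := by exact_mod_cast hx0.ne'
  have hxν : ((x ^ ν : ℝ) : ℂ) ≠ 0 := by exact_mod_cast (Real.rpow_pos_of_pos hx0 ν).ne'
  have e1 : (ω : ℂ) - x ≠ 0 := by
    rw [← Complex.ofReal_sub]
    exact_mod_cast (by linarith : ω - x < 0).ne
  have e2 : (ω : ℂ) + x ≠ 0 := by
    rw [← Complex.ofReal_add]
    exact_mod_cast (by linarith : 0 < ω + x).ne'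
  rw [hilbertIntegrand_add_neg ν f hx0, hilbertIntegrand_add_neg ν f hx0, momentIntegrand,
    Real.rpow_neg hx0.le, Real.rpow_natCast,
    show ((0 : ℕ) : ℝ) + ν + 1 = ν + ((1 : ℕ) : ℝ) by push_cast; ring,
    Real.rpow_add_natCast hx0.ne']
  push_cast
  rw [show -(ω : ℂ) - x = -(ω + x) by ring, show -(ω : ℂ) + x = -(ω - x) by ring]
  field_simp
  ring

/-- The difference of the folded integrands isolates `f x - f (-x)`, here with the factor `2 ω / (ω
^ 2 - x ^ 2)`. -/
lemma momentIntegrand_one_eq (ν : ℝ) (f : ℝ → ℂ) {ω x : ℝ} (hω : 0 < ω) (hx : ω < x) :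
    momentIntegrand ν f 1 x =
      ((ω : ℂ) / 2) * (((hilbertIntegrand ν f ω x + hilbertIntegrand ν f ω (-x)) -
        (hilbertIntegrand ν f (-ω) x + hilbertIntegrand ν f (-ω) (-x))) *
          ((x ^ (-((2 : ℕ) : ℝ)) : ℝ) : ℂ)) +
      (-1 / (2 * ω)) * ((hilbertIntegrand ν f ω x + hilbertIntegrand ν f ω (-x)) -
        (hilbertIntegrand ν f (-ω) x + hilbertIntegrand ν f (-ω) (-x))) := by
  have hx0 : 0 < x := hω.trans hx
  have hxc : (x : ℂ) ≠ 0 := by exact_mod_cast hx0.ne'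
  have hωc : (ω : ℂ) ≠ 0 := by exact_mod_cast hω.ne'
  have hxν : ((x ^ ν : ℝ) : ℂ) ≠ 0 := by exact_mod_cast (Real.rpow_pos_of_pos hx0 ν).ne'
  have e1 : (ω : ℂ) - x ≠ 0 := by
    rw [← Complex.ofReal_sub]
    exact_mod_cast (by linarith : ω - x < 0).ne
  have e2 : (ω : ℂ) + x ≠ 0 := by
    rw [← Complex.ofReal_add]
    exact_mod_cast (by linarith : 0 < ω + x).ne'
  rw [hilbertIntegrand_add_neg ν f hx0, hilbertIntegrand_add_neg ν f hx0, momentIntegrand,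
    Real.rpow_neg hx0.le, Real.rpow_natCast,
    show ((1 : ℕ) : ℝ) + ν + 1 = ν + ((2 : ℕ) : ℝ) by push_cast; ring,
    Real.rpow_add_natCast hx0.ne']
  push_cast
  rw [show -(ω : ℂ) - x = -(ω + x) by ring, show -(ω : ℂ) + x = -(ω - x) by ring]
  field_simp
  ring

lemma continuousOn_momentIntegrand_Ioi (ν : ℝ) {f : ℝ → ℂ} (hf : Continuous f) (k : ℕ) :
    ContinuousOn (momentIntegrand ν f k) (Ioi 0) := fun x hx =>
  ((continuousOn_momentIntegrand (hf.continuousOn (s := Icc (-(x + 1)) (x + 1))) k).continuousAt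
    (mem_of_superset (Ioo_mem_nhds hx (lt_add_one x)) Ioo_subset_Ioc_self)).continuousWithinAt

lemma tendsto_integral_change_left {φ : ℝ → ℂ} (hφ : ContinuousOn φ (Ioi 0)) {R R' : ℝ}
    (hR : 0 < R) (hR' : 0 < R') {L : ℂ} (hL : Tendsto (fun b => ∫ x in R..b, φ x) atTop (𝓝 L)) :
    ∃ L', Tendsto (fun b => ∫ x in R'..b, φ x) atTop (𝓝 L') := by
  have hi : ∀ {c d : ℝ}, 0 < c → 0 < d → IntervalIntegrable φ volume c d := fun hc hd =>
    (hφ.mono (ordConnected_Ioi.uIcc_subset hc hd)).intervalIntegrable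
  refine ⟨_, (hL.const_add (∫ x in R'..R, φ x)).congr' ?_⟩
  filter_upwards [eventually_gt_atTop 0] with b hb
  exact intervalIntegral.integral_add_adjacent_intervals (hi hR' hR) (hi hR hb)

/-- One pair `±ω` settles the moments `0` and `1`. Every other moment integrand is one of these two
times a power `x ^ (-2 i)`. -/
lemma tendsto_integral_momentIntegrand {ν ω : ℝ} {f : ℝ → ℂ} (hf : Continuous f) (hω : 0 < ω)
    {v v' : ℂ} (h : HasPV (hilbertIntegrand ν f ω) ω ∞ v)
    (h' : HasPV (hilbertIntegrand ν f (-ω)) (-ω) ∞ v') {R : ℝ} (hR : 0 < R) (k : ℕ) :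
    ∃ L, Tendsto (fun b => ∫ x in R..b, momentIntegrand ν f k x) atTop (𝓝 L) := by
  have hcont : ∀ τ : ℝ, |τ| ≤ ω → ContinuousOn
      (fun x => hilbertIntegrand ν f τ x + hilbertIntegrand ν f τ (-x)) (Ioi ω) := fun τ hτ => by
    obtain ⟨t1, t2⟩ := abs_le.1 hτ
    have hc := continuousOn_hilbertIntegrand (ν := ν) (ω := τ) (hf.continuousOn (s := univ))
    refine (hc.mono fun x hx => ⟨mem_univ _, ?_⟩).add
      (hc.comp continuousOn_neg fun x hx => ⟨mem_univ _, ?_⟩)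
    all_goals
      have hx' : ω < x := hx
      rintro (h | h) <;> [skip; rw [mem_singleton_iff] at h] <;> linarith
  have hωR : ω < ω + 1 := lt_add_one ω
  obtain ⟨L₁, hL₁⟩ := exists_tendsto_of_hasPV_top hf (by rwa [abs_of_pos hω]) h
  obtain ⟨L₂, hL₂⟩ := exists_tendsto_of_hasPV_top (R := ω + 1) hf
    (by rwa [abs_neg, abs_of_pos hω]) h'
  have c₁ := hcont ω (abs_of_pos hω).le
  have c₂ := hcont (-ω) (by rw [abs_neg, abs_of_pos hω])
  have hi : ∀ {φ : ℝ → ℂ}, ContinuousOn φ (Ioi ω) → ∀ b, ω + 1 ≤ b →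
      IntervalIntegrable φ volume (ω + 1) b := fun hφ b hb =>
    (hφ.mono (ordConnected_Ioi.uIcc_subset hωR (hωR.trans_le hb))).intervalIntegrable
  have hrpow : ContinuousOn (fun x : ℝ => ((x ^ (-((2 : ℕ) : ℝ)) : ℝ) : ℂ)) (Ioi ω) :=
    Complex.continuous_ofReal.comp_continuousOn
      (continuousOn_id.rpow_const fun x hx => Or.inl (hω.trans hx).ne')
  have key : ∀ {φ ψ : ℝ → ℂ} {L A B : ℂ}, ContinuousOn φ (Ioi ω) →
      Tendsto (fun b => ∫ x in (ω + 1)..b, φ x) atTop (𝓝 L) →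
      (∀ x, ω < x → ψ x = A * (φ x * ((x ^ (-((2 : ℕ) : ℝ)) : ℝ) : ℂ)) + B * φ x) →
      ∃ L', Tendsto (fun b => ∫ x in (ω + 1)..b, ψ x) atTop (𝓝 L') := by
    intro φ ψ L A B hφ hL hψ
    obtain ⟨L', hL'⟩ := tendsto_integral_mul_rpow_neg hω.le hωR hφ hL 2
    refine ⟨_, ((hL'.const_mul A).add (hL.const_mul B)).congr' ?_⟩
    filter_upwards [eventually_ge_atTop (ω + 1)] with b hb
    have hi₁ : IntervalIntegrable (fun x => A * (φ x * ((x ^ (-((2 : ℕ) : ℝ)) : ℝ) : ℂ)))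
        volume (ω + 1) b := (hi (hφ.mul hrpow) b hb).const_mul A
    rw [← intervalIntegral.integral_const_mul, ← intervalIntegral.integral_const_mul,
      ← intervalIntegral.integral_add hi₁ ((hi hφ b hb).const_mul B)]
    refine intervalIntegral.integral_congr fun x hx => (hψ x ?_).symm
    rw [uIcc_of_le hb] at hx
    exact hωR.trans_le hx.1
  have h0 : ∃ L, Tendsto (fun b => ∫ x in (ω + 1)..b, momentIntegrand ν f 0 x) atTop (𝓝 L) := by
    refine key (c₁.add c₂) ((hL₁.add hL₂).congr' ?_)
      fun x hx => momentIntegrand_zero_eq ν f hω hx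
    filter_upwards [eventually_ge_atTop (ω + 1)] with b hb
    exact (intervalIntegral.integral_add (hi c₁ b hb) (hi c₂ b hb)).symm
  have h1 : ∃ L, Tendsto (fun b => ∫ x in (ω + 1)..b, momentIntegrand ν f 1 x) atTop (𝓝 L) := by
    refine key (c₁.sub c₂) ((hL₁.sub hL₂).congr' ?_)
      fun x hx => momentIntegrand_one_eq ν f hω hx
    filter_upwards [eventually_ge_atTop (ω + 1)] with b hb
    exact (intervalIntegral.integral_sub (hi c₁ b hb) (hi c₂ b hb)).symm
  have hω1 : 0 < ω + 1 := by linarith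
  have hall : ∀ e, (∃ L, Tendsto (fun b => ∫ x in (ω + 1)..b, momentIntegrand ν f e x) atTop
      (𝓝 L)) → ∀ i, ∃ L, Tendsto (fun b => ∫ x in R..b, momentIntegrand ν f (e + 2 * i) x)
      atTop (𝓝 L) := by
    rintro e ⟨L, hL⟩ i
    obtain ⟨L', hL'⟩ := tendsto_integral_mul_rpow_neg le_rfl hω1
      (continuousOn_momentIntegrand_Ioi ν hf e) hL (2 * i)
    refine tendsto_integral_change_left (continuousOn_momentIntegrand_Ioi ν hf _) hω1 hR
      (hL'.congr' ?_)
    filter_upwards [eventually_ge_atTop (ω + 1)] with b hb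
    refine intervalIntegral.integral_congr fun x hx => ?_
    rw [uIcc_of_le hb] at hx
    exact (momentIntegrand_add_two_mul ν f e i (hω1.trans_le hx.1)).symm
  obtain ⟨i, rfl | rfl⟩ := k.even_or_odd'
  · simpa using hall 0 h0 i
  · rw [add_comm]
    exact hall 1 h1 i

lemma exists_bound_integral_momentIntegrand {ν : ℝ} {f : ℝ → ℂ} (hf : Continuous f) {R : ℝ}
    (hR : 0 < R)
    (h : ∀ k, ∃ L, Tendsto (fun b => ∫ x in R..b, momentIntegrand ν f k x) atTop (𝓝 L)) :
    ∃ M, ∀ k b, R ≤ b → ‖∫ x in R..b, momentIntegrand ν f k x‖ ≤ M * (R ^ k)⁻¹ := by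
  have hc := continuousOn_momentIntegrand_Ioi ν hf
  obtain ⟨L₀, h₀⟩ := h 0
  obtain ⟨L₁, h₁⟩ := h 1
  obtain ⟨M₀, hM₀⟩ := exists_bound_integral_of_tendsto hR (hc 0) h₀
  obtain ⟨M₁, hM₁⟩ := exists_bound_integral_of_tendsto hR (hc 1) h₁
  have hall : ∀ e M, (∀ b, R ≤ b → ‖∫ x in R..b, momentIntegrand ν f e x‖ ≤ M) → ∀ i b, R ≤ b →
      ‖∫ x in R..b, momentIntegrand ν f (e + 2 * i) x‖ ≤ M * (R ^ (2 * i))⁻¹ := by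
    intro e M hM i b hb
    have h1 := norm_integral_mul_rpow_neg_le le_rfl hR (hc e) hM (2 * i) hb
    rw [Real.rpow_neg hR.le, Real.rpow_natCast] at h1
    rwa [intervalIntegral.integral_congr fun x hx =>
      momentIntegrand_add_two_mul ν f e i (hR.trans_le (by rw [uIcc_of_le hb] at hx; exact hx.1))]
  -- For odd `k = 2 i + 1` the bound is `M₁ R ^ (-2 i) = (M₁ R) R ^ (-k)`.
  refine ⟨max M₀ (M₁ * R), fun k b hb => ?_⟩
  obtain ⟨i, rfl | rfl⟩ := k.even_or_odd'
  · have := hall 0 M₀ hM₀ i b hb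
    rw [zero_add] at this
    exact this.trans (mul_le_mul_of_nonneg_right (le_max_left _ _) (by positivity))
  · have := hall 1 M₁ hM₁ i b hb
    rw [add_comm 1] at this
    refine this.trans (le_trans (le_of_eq ?_)
      (mul_le_mul_of_nonneg_right (le_max_right M₀ (M₁ * R)) (by positivity)))
    rw [pow_succ]
    field_simp

/-- The moments over `[0, b]` converge to those over `[0, ∞)`, and the expansion of the principal
value passes to the limit. -/
lemma hasPV_top_of_moments {ν : ℝ} (hν : ν ∈ Ioo (0 : ℝ) 1) {α : ℕ → ℂ} {f : ℝ → ℂ}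
    (hf : Continuous f) {c : ℕ → ℂ}
    (hlim : ∀ {R : ℝ}, 0 < R → ∀ k, ∃ L,
      Tendsto (fun b => ∫ x in R..b, momentIntegrand ν f k x) atTop (𝓝 L))
    (hc : ∀ k, Tendsto (finitePartMoment ν α f k) atTop (𝓝 (c k)))
    {ω R : ℝ} (hω : ω ≠ 0) (hωR : |ω| < R) (h : HasExpansionOn α f R) :
    Summable (fun k : ℕ => (ω : ℂ) ^ k * c k) ∧
    HasPV (hilbertIntegrand ν f ω) ω ∞
      (-(∑' k : ℕ, (ω : ℂ) ^ k * c k) - ((Real.pi * Real.cot (Real.pi * ν / 2) : ℝ) : ℂ) *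
        (f ω / ((|ω| ^ ν : ℝ) : ℂ))) := by
  have hR : 0 < R := (abs_nonneg ω).trans_lt hωR
  obtain ⟨M, hM⟩ := exists_bound_integral_momentIntegrand hf hR (hlim hR)
  obtain ⟨S₀, hS₀, -⟩ := h.hasPVOn_extend hν hω hωR le_rfl hf.continuousOn
  -- A majorant uniform in `b ≥ R`: the moment over `[0, R]` plus the bound on the tail over `[R,
  -- b]`, geometric since `|ω| < R`.
  have hbs : Summable fun k : ℕ => ‖(ω : ℂ) ^ k * finitePartMoment ν α f k R‖ +
      M * (|ω| / R) ^ k :=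
    hS₀.summable.norm.add ((summable_geometric_of_lt_one (by positivity)
      ((div_lt_one hR).2 hωR)).mul_left M)
  have hle : ∀ b, R ≤ b → ∀ k, ‖(ω : ℂ) ^ k * finitePartMoment ν α f k b‖ ≤
      ‖(ω : ℂ) ^ k * finitePartMoment ν α f k R‖ + M * (|ω| / R) ^ k := fun b hb k => by
    rw [(finitePartMoment_extend hν hR hb hf.continuousOn
      (finitePartMoment_of_expansion hν hR h k).1).2, mul_add]
    refine (norm_add_le _ _).trans (add_le_add le_rfl ?_)
    rw [norm_mul, norm_pow, Complex.norm_real, Real.norm_eq_abs]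
    calc |ω| ^ k * ‖∫ x in R..b, momentIntegrand ν f k x‖ ≤ |ω| ^ k * (M * (R ^ k)⁻¹) := by
          gcongr
          exact hM k b hb
      _ = _ := by
          rw [div_pow]
          ring
  have hterm : ∀ k, Tendsto (fun b => (ω : ℂ) ^ k * finitePartMoment ν α f k b) atTop
      (𝓝 ((ω : ℂ) ^ k * c k)) := fun k => (hc k).const_mul _
  refine ⟨Summable.of_norm_bounded hbs fun k => ?_, fun h => absurd rfl h, fun _ =>
    ⟨fun b => -(∑' k : ℕ, (ω : ℂ) ^ k * finitePartMoment ν α f k b) -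
      ((Real.pi * Real.cot (Real.pi * ν / 2) : ℝ) : ℂ) * (f ω / ((|ω| ^ ν : ℝ) : ℂ)), ?_, ?_⟩⟩
  · refine le_of_tendsto (hterm k).norm ?_
    filter_upwards [eventually_ge_atTop R] with b hb
    exact hle b hb k
  · filter_upwards [eventually_ge_atTop R] with b hb
    obtain ⟨S, hS, hpv⟩ := h.hasPVOn_extend hν hω hωR hb hf.continuousOn
    rwa [hS.tsum_eq]
  · refine ((tendsto_tsum_of_dominated_convergence hbs hterm ?_).neg).sub_const _
    filter_upwards [eventually_ge_atTop R] with b hb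
    exact hle b hb

/-! ### Taylor expansions -/

lemma HasExpansionOn.mono {α : ℕ → ℂ} {f : ℝ → ℂ} {R r : ℝ} (h : HasExpansionOn α f R)
    (hr : 0 ≤ r) (hrR : r ≤ R) : HasExpansionOn α f r := by
  refine ⟨h.1.of_nonneg_of_le (fun n => by positivity) fun n => ?_, fun x hx => h.2 x (hx.trans hrR)⟩
  gcongr

lemma HasExpansionOn.unique {α β : ℕ → ℂ} {f : ℝ → ℂ} {R r : ℝ} (hR : 0 < R) (hr : 0 < r)
    (h : HasExpansionOn α f R) (h' : HasExpansionOn β f r) : α = β := by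
  let P : (ℕ → ℂ) → FormalMultilinearSeries ℝ ℝ ℂ := fun γ n =>
    ContinuousMultilinearMap.mkPiRing ℝ (Fin n) (γ n)
  have hP : ∀ γ n, (P γ).coeff n = γ n := fun γ n => by
    rw [FormalMultilinearSeries.coeff, ContinuousMultilinearMap.mkPiRing_apply]
    simp
  have key : ∀ {γ : ℕ → ℂ} {s : ℝ}, 0 < s → HasExpansionOn γ f s →
      HasFPowerSeriesAt f (P γ) (0 : ℝ) := by
    intro γ s hs hγ
    refine hasFPowerSeriesAt_iff.2 ?_
    filter_upwards [Metric.closedBall_mem_nhds (0 : ℝ) hs] with x hx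
    rw [mem_closedBall_zero_iff, Real.norm_eq_abs] at hx
    rw [zero_add]
    refine (hγ.2 x hx).congr_fun fun n => ?_
    rw [hP, Complex.real_smul, Complex.ofReal_pow, mul_comm]
  have heq := (key hR h).eq_formalMultilinearSeries (key hr h')
  ext n
  rw [← hP α n, heq, hP]

lemma symmInterval_mem_nhds {a : ℝ≥0∞} (ha : 0 < a) : symmInterval a ∈ 𝓝 (0 : ℝ) := by
  have h : Tendsto (fun x : ℝ => ‖x‖ₑ) (𝓝 0) (𝓝 0) := by
    simpa using (continuous_enorm (E := ℝ)).tendsto 0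
  filter_upwards [h.eventually_le_const ha] with x hx
  exact hx

lemma Icc_subset_symmInterval {a : ℝ≥0∞} {b : ℝ} (hb : ‖b‖ₑ ≤ a) :
    Icc (-b) b ⊆ symmInterval a := by
  intro x hx
  have hb0 : 0 ≤ b := by linarith [hx.1, hx.2]
  refine le_trans ?_ hb
  rw [enorm_le_iff_norm_le, Real.norm_eq_abs, Real.norm_eq_abs, abs_of_nonneg hb0]
  exact abs_le.2 hx

lemma ComplexAnalyticIn.continuousOn {f : ℝ → ℂ} {s : Set ℝ} (hf : ComplexAnalyticIn f s) :
    ContinuousOn f s := by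
  obtain ⟨F, hF, hFf⟩ := hf
  refine (hF.continuousOn.comp Complex.continuous_ofReal.continuousOn
    fun x hx => mem_image_of_mem _ hx).congr fun x hx => (hFf x hx).symm

lemma singularityDistance_pos {f : ℝ → ℂ} {a : ℝ≥0∞} (ha : 0 < a)
    (hf : ComplexAnalyticIn f (symmInterval a)) : 0 < singularityDistance f := by
  obtain ⟨F, hF, hFf⟩ := hf
  have h0 : AnalyticAt ℂ F 0 := hF 0 ⟨0, by simp [symmInterval], by simp⟩
  obtain ⟨r, hr, hrb⟩ := Metric.mem_nhds_iff.1 h0.eventually_analyticAt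
  refine (ENNReal.ofReal_pos.2 hr).trans_le (le_sSup ⟨F, fun z hz => hrb ?_, ?_⟩)
  · rw [mem_ball_zero_iff]
    rwa [Set.mem_ofPred_eq, ← ofReal_norm, ENNReal.ofReal_lt_ofReal_iff hr] at hz
  · filter_upwards [symmInterval_mem_nhds ha] with x hx
    exact hFf x hx

lemma exists_hasExpansionOn {f : ℝ → ℂ} {a : ℝ≥0∞} (ha : 0 < a)
    (hf : ComplexAnalyticIn f (symmInterval a)) {R : ℝ} (hR : 0 ≤ R) (hRa : ‖R‖ₑ ≤ a)
    (hRρ : ‖R‖ₑ < singularityDistance f) : ∃ α, HasExpansionOn α f R := by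
  obtain ⟨F, hF, hFf⟩ := hf
  obtain ⟨r, ⟨G, hG, hGf⟩, hRr⟩ := lt_sSup_iff.1 hRρ
  obtain ⟨r', hr1, hr2⟩ := ENNReal.lt_iff_exists_nnreal_btwn.1 hRr
  have hRr' : R < r' := by
    rw [← ofReal_norm, Real.norm_of_nonneg hR, ENNReal.ofReal_lt_coe_iff hR] at hr1
    exact hr1
  have hr'0 : 0 < r' := by exact_mod_cast hR.trans_lt hRr'
  have hball : ∀ z : ℂ, ‖z‖ ≤ r' → AnalyticAt ℂ G z := fun z hz => hG z (by
    refine lt_of_le_of_lt ?_ hr2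
    rw [← ofReal_norm, ← ENNReal.ofReal_coe_nnreal]
    exact ENNReal.ofReal_le_ofReal hz)
  have hps : HasFPowerSeriesOnBall G (cauchyPowerSeries G 0 r') 0 r' :=
    DifferentiableOn.hasFPowerSeriesOnBall (fun z hz => (hball z
      (mem_closedBall_zero_iff.1 hz)).differentiableAt.differentiableWithinAt) hr'0
  set p := cauchyPowerSeries G 0 r'
  have han : ∀ (H : ℂ → ℂ) (x : ℝ), AnalyticAt ℂ H x → AnalyticAt ℝ (fun y : ℝ => H y) x :=
    fun H x hH => AnalyticAt.comp (g := H) (f := fun y : ℝ => (y : ℂ)) hH.restrictScalars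
      (Complex.ofRealCLM.analyticAt x)
  -- The extension `F` near the interval and the extension `G` on the disc are tied only by their
  -- germs on the real line at `0`. The identity theorem for real-analytic functions makes them
  -- agree along `[-R, R]`.
  have heq : EqOn (fun x : ℝ => F x) (fun x : ℝ => G x) (Icc (-R) R) := by
    refine AnalyticOnNhd.eqOn_of_preconnected_of_eventuallyEq (𝕜 := ℝ) (z₀ := 0)
      (fun x hx => han F x (hF _ ⟨x, Icc_subset_symmInterval hRa hx, rfl⟩))
      (fun x hx => han G x (hball _ ?_)) isPreconnected_Icc ⟨by linarith, hR⟩ ?_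
    · rw [Complex.norm_real, Real.norm_eq_abs]
      exact (abs_le.2 hx).trans hRr'.le
    · filter_upwards [symmInterval_mem_nhds ha, hGf] with x hx hx'
      exact (hFf x hx).trans hx'.symm
  refine ⟨fun n => p.coeff n, ?_, fun x hx => ?_⟩
  · have := p.summable_norm_mul_pow (r := ⟨R, hR⟩) (lt_of_lt_of_le
      (ENNReal.coe_lt_coe.2 (NNReal.coe_lt_coe.1 hRr')) hps.r_le)
    refine this.congr fun n => ?_
    rw [FormalMultilinearSeries.norm_apply_eq_norm_coef]
    rfl
  · have hx' : x ∈ Icc (-R) R := abs_le.1 hx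
    rw [← hFf x (Icc_subset_symmInterval hRa hx')]
    rw [show F x = G x from heq hx']
    have := hps.hasSum (y := (x : ℂ)) (by
      rw [Metric.mem_eball, edist_zero_right, ← ofReal_norm, Complex.norm_real,
        Real.norm_eq_abs, ENNReal.ofReal_lt_coe_iff (abs_nonneg x)]
      exact hx.trans_lt hRr')
    rw [zero_add] at this
    refine this.congr_fun fun n => ?_
    rw [FormalMultilinearSeries.apply_eq_pow_smul_coeff, smul_eq_mul, mul_comm]

/-- The Taylor coefficients at `0` give the expansion of `f` up to the nearest singularity. -/
lemma exists_taylor {f : ℝ → ℂ} {a : ℝ≥0∞} (ha : 0 < a)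
    (hf : ComplexAnalyticIn f (symmInterval a)) :
    ∃ α, ∀ R : ℝ, 0 < R → ‖R‖ₑ ≤ a → ‖R‖ₑ < singularityDistance f → HasExpansionOn α f R := by
  obtain ⟨r, hr0, hr⟩ := ENNReal.lt_iff_exists_nnreal_btwn.1
    (lt_min ha (singularityDistance_pos ha hf))
  have hr' : ‖(r : ℝ)‖ₑ = r := by simp
  obtain ⟨α, hα⟩ := exists_hasExpansionOn ha hf r.2
    (by rw [NNReal.val_eq_coe, hr']; exact (hr.trans_le (min_le_left _ _)).le)
    (by rw [NNReal.val_eq_coe, hr']; exact hr.trans_le (min_le_right _ _))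
  refine ⟨α, fun R hR h1 h2 => ?_⟩
  obtain ⟨β, hβ⟩ := exists_hasExpansionOn ha hf hR.le h1 h2
  -- Coefficients obtained at different radii coincide by uniqueness of power series, so one
  -- sequence serves every `R`.
  rwa [hα.unique (by exact_mod_cast hr0) hR hβ]

lemma exists_between_enorm {ω : ℝ} {a : ℝ≥0∞} (h : ‖ω‖ₑ < a) :
    ∃ R : ℝ, |ω| < R ∧ ‖R‖ₑ < a := by
  obtain ⟨r, h1, h2⟩ := ENNReal.lt_iff_exists_nnreal_btwn.1 h
  refine ⟨r, ?_, by simpa using h2⟩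
  rwa [← ofReal_norm, ENNReal.ofReal_lt_coe_iff (norm_nonneg _), Real.norm_eq_abs] at h1

/-! ### The expansion of the principal value -/

/-- `c k` is the `k`-th moment of `f` over `[0, a]`, as a limit if `a = ∞`, where `α` are the
Taylor coefficients of `f` at `0`, and the principal value has an expansion in these moments. -/
structure IsMomentExpansion (ν : ℝ) (a : ℝ≥0∞) (f : ℝ → ℂ) (α c : ℕ → ℂ) : Prop where
  continuousOn : ContinuousOn f (symmInterval a)
  expansion : ∃ R > 0, HasExpansionOn α f R
  withLimit : ∀ (k : ℕ) (P : ℝ → ℂ → Prop),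
    (∀ b : ℝ, 0 < b → ‖b‖ₑ ≤ a → P b (finitePartMoment ν α f k b)) → WithLimit P a (c k)
  hasPV : ∀ ω : ℝ, ω ≠ 0 → ‖ω‖ₑ < a → ‖ω‖ₑ < singularityDistance f →
    Summable (fun k : ℕ => (ω : ℂ) ^ k * c k) ∧
    HasPV (hilbertIntegrand ν f ω) ω a
      (-(∑' k : ℕ, (ω : ℂ) ^ k * c k)
        - ((Real.pi * Real.cot (Real.pi * ν / 2) : ℝ) : ℂ) * (f ω / ((|ω| ^ ν : ℝ) : ℂ)))

lemma intervalIntegrable_sub_singularPart {ν : ℝ} (hν : ν ∈ Ioo (0 : ℝ) 1) {α : ℕ → ℂ}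
    {f : ℝ → ℂ} (h : ∃ R > 0, HasExpansionOn α f R) {b : ℝ} (hb : 0 < b)
    (hf : ContinuousOn f (Icc (-b) b)) (k : ℕ) :
    IntervalIntegrable (fun x => momentIntegrand ν f k x - singularPart ν α k x) volume 0 b := by
  obtain ⟨R, hR, hexp⟩ := h
  have hr : 0 < min R b := lt_min hR hb
  exact (finitePartMoment_extend hν hr (min_le_right _ _) hf (finitePartMoment_of_expansion hν hr
    (hexp.mono hr.le (min_le_left _ _)) k).1).1

theorem exists_isMomentExpansion {ν : ℝ} (hν : ν ∈ Ioo (0 : ℝ) 1) {a : ℝ≥0∞} (ha : 0 < a)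
    {f : ℝ → ℂ} (hf : ComplexAnalyticIn f (symmInterval a))
    (hPV : a = ∞ → ∀ ω : ℝ, ω ≠ 0 → ‖ω‖ₑ < singularityDistance f →
      ∃ v : ℂ, HasPV (hilbertIntegrand ν f ω) ω a v) :
    ∃ α c, IsMomentExpansion ν a f α c := by
  obtain ⟨α, hα⟩ := exists_taylor ha hf
  have hcont := hf.continuousOn
  obtain ⟨R₀, hR₀, hR₀'⟩ : ∃ R : ℝ, 0 < R ∧ ‖R‖ₑ < min a (singularityDistance f) := by
    have := exists_between_enorm (ω := 0) (a := min a (singularityDistance f))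
      (by simpa using ⟨ha, singularityDistance_pos ha hf⟩)
    simpa using this
  have hexp : ∃ R > 0, HasExpansionOn α f R :=
    ⟨R₀, hR₀, hα R₀ hR₀ (hR₀'.trans_le (min_le_left _ _)).le (hR₀'.trans_le (min_le_right _ _))⟩
  by_cases hainf : a = ∞
  · subst hainf
    have hfc : Continuous f := by
      rw [← continuousOn_univ]
      exact hcont.mono fun x _ => show ‖x‖ₑ ≤ ∞ from le_top
    -- Principal values at the single pair `±R₀` give convergence of all moments.
    obtain ⟨v, hv⟩ := hPV rfl R₀ hR₀.ne' (hR₀'.trans_le (min_le_right _ _))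
    obtain ⟨v', hv'⟩ := hPV rfl (-R₀) (neg_ne_zero.2 hR₀.ne')
      (by rw [enorm_neg]; exact hR₀'.trans_le (min_le_right _ _))
    have hlim : ∀ {R : ℝ}, 0 < R → ∀ k, ∃ L,
        Tendsto (fun b => ∫ x in R..b, momentIntegrand ν f k x) atTop (𝓝 L) := fun hR k =>
      tendsto_integral_momentIntegrand hfc hR₀ hv hv' hR k
    have hfp : ∀ k, ∃ L, Tendsto (finitePartMoment ν α f k) atTop (𝓝 L) := fun k => by
      obtain ⟨L, hL⟩ := hlim one_pos k
      refine ⟨_, (hL.const_add (finitePartMoment ν α f k 1)).congr' ?_⟩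
      filter_upwards [eventually_ge_atTop 1] with b hb
      exact (finitePartMoment_extend hν one_pos hb hfc.continuousOn
        (intervalIntegrable_sub_singularPart hν hexp one_pos hfc.continuousOn k)).2.symm
    choose c hc using hfp
    refine ⟨α, c, hcont, hexp, fun k P hP => ⟨fun h => absurd rfl h, fun _ =>
      ⟨finitePartMoment ν α f k, ?_, hc k⟩⟩, fun ω hω _ hωρ => ?_⟩
    · filter_upwards [eventually_gt_atTop 0] with b hb
      exact hP b hb le_top
    · obtain ⟨R, hωR, hR⟩ := exists_between_enorm hωρ
      exact hasPV_top_of_moments hν hfc hlim hc hω hωR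
        (hα R ((abs_nonneg ω).trans_lt hωR) le_top hR)
  · have hb0 : 0 < a.toReal := ENNReal.toReal_pos ha.ne' hainf
    have hba : ‖a.toReal‖ₑ = a := by
      rw [← ofReal_norm, Real.norm_of_nonneg hb0.le, ENNReal.ofReal_toReal hainf]
    refine ⟨α, fun k => finitePartMoment ν α f k a.toReal, hcont, hexp, fun k P hP =>
      ⟨fun _ => hP _ hb0 hba.le, fun h => absurd h hainf⟩, fun ω hω hωa hωρ => ?_⟩
    obtain ⟨R, hωR, hR⟩ := exists_between_enorm (lt_min hωa hωρ)
    have hR0 : 0 < R := (abs_nonneg ω).trans_lt hωR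
    have hRa := hR.trans_le (min_le_left _ _)
    have hRb : R ≤ a.toReal := by
      rw [← ofReal_norm, Real.norm_of_nonneg hR0.le] at hRa
      exact (ENNReal.ofReal_le_iff_le_toReal hainf).1 hRa.le
    obtain ⟨S, hS, hpv⟩ := (hα R hR0 hRa.le (hR.trans_le (min_le_right _ _))).hasPVOn_extend hν hω
      hωR hRb (hcont.mono (Icc_subset_symmInterval hba.le))
    refine ⟨hS.summable, fun _ => ?_, fun h => absurd h hainf⟩
    rwa [hS.tsum_eq]

/-! ### Rewriting the moments in the special cases -/

lemma HasFinitePartOn.congr {h₁ h₂ : ℝ → ℂ} {b : ℝ} {v : ℂ} (H : HasFinitePartOn h₁ b v)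
    (hb : 0 < b) (heq : ∀ x ∈ Ioc 0 b, h₁ x = h₂ x) : HasFinitePartOn h₂ b v := by
  obtain ⟨hi, D, hD, hlim⟩ := H
  refine ⟨fun ε hε => (hi ε hε).congr fun x hx => ?_, D, hD, hlim.congr' ?_⟩
  · rw [uIoc_of_le hε.2.le] at hx
    exact heq x ⟨hε.1.trans hx.1, hx.2⟩
  · filter_upwards [Ioo_mem_nhdsGT hb] with ε hε
    rw [intervalIntegral.integral_congr fun x hx => heq x ?_]
    rw [uIcc_of_le hε.2.le] at hx
    exact ⟨hε.1.trans_le hx.1, hx.2⟩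

lemma HasFinitePartOn.const_mul {h : ℝ → ℂ} {b : ℝ} {v : ℂ} (H : HasFinitePartOn h b v) (s : ℂ) :
    HasFinitePartOn (fun x => s * h x) b (s * v) := by
  obtain ⟨hi, D, hD, hlim⟩ := H
  refine ⟨fun ε hε => (hi ε hε).const_mul s, s • D, Submodule.smul_mem _ _ hD,
    (hlim.const_mul s).congr fun ε => ?_⟩
  rw [intervalIntegral.integral_const_mul, Pi.smul_apply, smul_eq_mul]
  ring

lemma WithLimit.const_mul {P : ℝ → ℂ → Prop} {a : ℝ≥0∞} {v : ℂ} (s : ℂ)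
    (H : WithLimit (fun b w => P b (s * w)) a v) : WithLimit P a (s * v) :=
  ⟨H.1, fun h => by
    obtain ⟨I, hI, hlim⟩ := H.2 h
    exact ⟨fun b => s * I b, hI, hlim.const_mul s⟩⟩

namespace IsMomentExpansion

variable {ν : ℝ} {a : ℝ≥0∞} {f : ℝ → ℂ} {α c : ℕ → ℂ}

lemma hasFinitePart_mul (H : IsMomentExpansion ν a f α c) (hν : ν ∈ Ioo (0 : ℝ) 1) {k : ℕ}
    (s : ℂ) {h : ℝ → ℂ}
    (heq : ∀ x, 0 < x → x ∈ symmInterval a → s * momentIntegrand ν f k x = h x) :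
    HasFinitePart h a (s * c k) := by
  refine WithLimit.const_mul s (H.withLimit k _ fun b hb hba => ?_)
  have hsub := Icc_subset_symmInterval hba
  have hf := H.continuousOn.mono hsub
  refine ((hasFinitePartOn_momentIntegrand hν hb hf (intervalIntegrable_sub_singularPart hν
    H.expansion hb hf k)).const_mul s).congr hb fun x hx => heq x hx.1 (hsub ?_)
  exact ⟨by linarith [hx.1], hx.2⟩

lemma hasFinitePart (H : IsMomentExpansion ν a f α c) (hν : ν ∈ Ioo (0 : ℝ) 1) {k : ℕ}
    {h : ℝ → ℂ} (heq : ∀ x, 0 < x → x ∈ symmInterval a → momentIntegrand ν f k x = h x) :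
    HasFinitePart h a (c k) := by
  simpa using H.hasFinitePart_mul hν (k := k) 1 (h := h) (by simpa using heq)

/-- Without Taylor terms of degree at most `k` there is nothing to regularise: singular part and
primitive vanish, and the finite part is the integral itself. -/
lemma hasConvergentIntegral_mul (H : IsMomentExpansion ν a f α c) (hν : ν ∈ Ioo (0 : ℝ) 1)
    {k : ℕ} (hα : ∀ j ≤ k, α j = 0) (s : ℂ) {h : ℝ → ℂ}
    (heq : ∀ x, 0 < x → x ∈ symmInterval a → s * momentIntegrand ν f k x = h x) :
    HasConvergentIntegral h a (s * c k) := by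
  refine WithLimit.const_mul s (H.withLimit k _ fun b hb hba => ?_)
  have hsub := Icc_subset_symmInterval hba
  have hf := H.continuousOn.mono hsub
  have hsing : ∀ x, singularPart ν α k x = 0 := fun x => Finset.sum_eq_zero fun j hj => by
    rw [hα j (Nat.lt_succ_iff.1 (Finset.mem_range.1 hj)), zero_mul]
  have hprim : singularPrimitive ν α k b = 0 := Finset.sum_eq_zero fun j hj => by
    rw [hα j (Nat.lt_succ_iff.1 (Finset.mem_range.1 hj)), zero_mul]
  have hi := intervalIntegrable_sub_singularPart hν H.expansion hb hf k
  have hval : finitePartMoment ν α f k b = ∫ x in (0 : ℝ)..b, momentIntegrand ν f k x := by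
    simp only [finitePartMoment, hsing, hprim, sub_zero, add_zero]
  simp only [hsing, sub_zero] at hi
  have hcongr : ∀ x ∈ Ioc 0 b, s * momentIntegrand ν f k x = h x := fun x hx =>
    heq x hx.1 (hsub ⟨by linarith [hx.1], hx.2⟩)
  refine ⟨(hi.const_mul s).congr fun x hx => hcongr x (by rwa [uIoc_of_le hb.le] at hx), ?_⟩
  rw [hval, ← intervalIntegral.integral_const_mul]
  refine intervalIntegral.integral_congr_ae (ae_of_all _ fun x hx => (hcongr x ?_).symm)
  rwa [uIoc_of_le hb.le] at hx

lemma hasConvergentIntegral (H : IsMomentExpansion ν a f α c) (hν : ν ∈ Ioo (0 : ℝ) 1)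
    {k : ℕ} (hα : ∀ j ≤ k, α j = 0) {h : ℝ → ℂ}
    (heq : ∀ x, 0 < x → x ∈ symmInterval a → momentIntegrand ν f k x = h x) :
    HasConvergentIntegral h a (c k) := by
  simpa using H.hasConvergentIntegral_mul hν hα 1 (h := h) (by simpa using heq)

lemma neg_mem_symmInterval {x : ℝ} (hx : x ∈ symmInterval a) : -x ∈ symmInterval a := by
  rwa [symmInterval, Set.mem_ofPred_eq, enorm_neg]

/-- The moments of the wrong parity vanish. -/
lemma moment_eq_zero (H : IsMomentExpansion ν a f α c) (ha : 0 < a) {m : ℕ}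
    (hpar : ∀ x ∈ symmInterval a, f (-x) = (-1) ^ m * f x) {k : ℕ} (hk : Odd (k + m)) :
    c k = 0 := by
  have hα : ∀ j, Odd (j + m) → α j = 0 := by
    obtain ⟨R, hR, hexp⟩ := H.expansion
    obtain ⟨r, hr0, hr⟩ := exists_between_enorm (ω := 0) (a := a) (by simpa using ha)
    rw [abs_zero] at hr0
    have hρ : 0 < min R r := lt_min hR hr0
    -- The parity of `f` gives a second expansion of the same function. Uniqueness turns it into `α
    -- j = -α j` for odd `j + m`.
    have hexp' : HasExpansionOn (fun n => (-1) ^ (n + m) * α n) f (min R r) := by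
      refine ⟨(hexp.mono hρ.le (min_le_left _ _)).1.congr fun n => by simp, fun x hx => ?_⟩
      have hxs : x ∈ symmInterval a := Icc_subset_symmInterval hr.le
        (abs_le.1 (hx.trans (min_le_right _ _)))
      have h1 := (hexp.2 (-x) (by rw [abs_neg]; exact hx.trans (min_le_left _ _))).mul_left
        ((-1) ^ m)
      rw [hpar x hxs, ← mul_assoc, ← pow_add, (Even.add_self m).neg_one_pow, one_mul] at h1
      refine h1.congr_fun fun n => ?_
      push_cast
      rw [neg_pow (x : ℂ)]
      ring
    intro j hj
    have := congrFun (hexp.unique hR hρ hexp') j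
    rw [hj.neg_one_pow] at this
    have h2 : (2 : ℂ) * α j = 0 := by linear_combination this
    simpa using h2
  have hz : ∀ j, α j = 0 ∨ Odd (k + j) := fun j => by
    rcases Nat.even_or_odd (j + m) with h | h
    · right
      have h1 : k + j + 2 * m = (k + m) + (j + m) := by ring
      have h2 : Odd (k + j + 2 * m) := h1 ▸ hk.add_even h
      exact (Nat.odd_add.1 h2).2 (even_two_mul m)
    · exact Or.inl (hα j h)
  -- The property carried to the limit is `v = 0` itself: for each finite `b` the moment already
  -- vanishes.
  have hlim := H.withLimit k (fun _ v => v = 0) fun b hb hba => by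
    have hprim : singularPrimitive ν α k b = 0 := Finset.sum_eq_zero fun j _ => by
      rcases hz j with h | h
      · rw [h, zero_mul]
      · rw [powerMoment_odd h, mul_zero]
    have hsing : ∀ x, singularPart ν α k x = 0 := fun x => Finset.sum_eq_zero fun j _ => by
      rcases hz j with h | h
      · rw [h, zero_mul]
      · rw [h.neg_one_pow, add_neg_cancel, zero_mul, mul_zero]
    simp only [finitePartMoment, hprim, hsing, sub_zero, add_zero]
    refine intervalIntegral.integral_zero_ae (ae_of_all _ fun x hx => ?_)
    rw [uIoc_of_le hb.le] at hx
    rw [momentIntegrand, hpar x (Icc_subset_symmInterval hba ⟨by linarith [hx.1], hx.2⟩),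
      ← mul_assoc, ← pow_add, hk.neg_one_pow, neg_one_mul, neg_add_cancel, zero_div]
  by_cases h : a = ∞
  · obtain ⟨I, hI, hI'⟩ := hlim.2 h
    exact tendsto_nhds_unique hI' (tendsto_const_nhds.congr' (hI.mono fun b hb => hb.symm))
  · exact hlim.1 h

/-- If `f(x) = x ^ m g(x)`, the first `m` Taylor coefficients of `f` vanish. -/
lemma coeff_eq_zero (H : IsMomentExpansion ν a f α c) (ha : 0 < a) {m : ℕ} {g : ℝ → ℂ}
    (hg : ComplexAnalyticIn g (symmInterval a))
    (hfg : ∀ x ∈ symmInterval a, f x = (x : ℂ) ^ m * g x) {j : ℕ} (hj : j < m) : α j = 0 := by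
  obtain ⟨R, hR, hexp⟩ := H.expansion
  obtain ⟨β, hβ⟩ := exists_taylor ha hg
  obtain ⟨r, hr0, hr⟩ := exists_between_enorm (ω := 0) (a := min a (singularityDistance g))
    (by simpa using ⟨ha, singularityDistance_pos ha hg⟩)
  rw [abs_zero] at hr0
  have hra := (hr.trans_le (min_le_left _ _)).le
  have hβr := hβ r hr0 hra (hr.trans_le (min_le_right _ _))
  have hexp' : HasExpansionOn (fun n => if n < m then 0 else β (n - m)) f r := by
    constructor
    · rw [← summable_nat_add_iff m]
      refine (hβr.1.mul_right (r ^ m)).congr fun n => ?_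
      simp only [not_lt.2 (Nat.le_add_left m n), if_false, Nat.add_sub_cancel, pow_add, mul_assoc]
    · intro x hx
      rw [hfg x (Icc_subset_symmInterval hra (abs_le.1 hx)), ← hasSum_nat_add_iff' m,
        Finset.sum_eq_zero fun i hi => by simp [Finset.mem_range.1 hi], sub_zero]
      refine ((hβr.2 x hx).mul_left ((x : ℂ) ^ m)).congr_fun fun n => ?_
      simp only [not_lt.2 (Nat.le_add_left m n), if_false, Nat.add_sub_cancel, pow_add]
      ring
  rw [hexp.unique hR hr0 hexp']
  simp [hj]

lemma momentIntegrand_of_pow_mul {m : ℕ} {g : ℝ → ℂ}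
    (hfg : ∀ x ∈ symmInterval a, f x = (x : ℂ) ^ m * g x) (k : ℕ) {x : ℝ} (hx0 : 0 < x)
    (hx : x ∈ symmInterval a) : momentIntegrand ν f k x =
      ((-1) ^ (k + m) * g (-x) + g x) / ((x ^ ((k : ℝ) - m + ν + 1) : ℝ) : ℂ) := by
  have hxc : (x : ℂ) ≠ 0 := by exact_mod_cast hx0.ne'
  have hxν : ((x ^ ((k : ℝ) + ν + 1) : ℝ) : ℂ) ≠ 0 := by
    exact_mod_cast (Real.rpow_pos_of_pos hx0 _).ne'
  rw [momentIntegrand, hfg x hx, hfg (-x) (neg_mem_symmInterval hx),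
    show (k : ℝ) - m + ν + 1 = k + ν + 1 - m by ring, Real.rpow_sub_natCast hx0.ne']
  push_cast
  rw [neg_pow (x : ℂ), pow_add]
  field_simp

/-- The moment of `f` of order `k + m` is the moment of `g` of order `k`, and those of order below
`m` are convergent integrals. The expansion is the general one, cut at `m`. -/
theorem of_pow_mul (H : IsMomentExpansion ν a f α c) (hν : ν ∈ Ioo (0 : ℝ) 1) (ha : 0 < a)
    {m : ℕ} {g : ℝ → ℂ} (hg : ComplexAnalyticIn g (symmInterval a))
    (hfg : ∀ x ∈ symmInterval a, f x = (x : ℂ) ^ m * g x) :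
    ∃ d c : ℕ → ℂ,
      (∀ k < m, HasConvergentIntegral
        (fun x : ℝ => ((-1) ^ (k + m) * g (-x) + g x) /
          ((x ^ ((k : ℝ) - m + ν + 1) : ℝ) : ℂ)) a (d k)) ∧
      (∀ k : ℕ, HasFinitePart
        (fun x : ℝ => ((-1) ^ k * g (-x) + g x) / ((x ^ ((k : ℝ) + ν + 1) : ℝ) : ℂ)) a (c k)) ∧
      ∀ ω : ℝ, ω ≠ 0 → ‖ω‖ₑ < a → ‖ω‖ₑ < singularityDistance f →
        Summable (fun k : ℕ => (ω : ℂ) ^ (k + m) * c k) ∧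
        HasPV (hilbertIntegrand ν f ω) ω a
          (-(∑ k ∈ Finset.range m, (ω : ℂ) ^ k * d k)
            - (∑' k : ℕ, (ω : ℂ) ^ (k + m) * c k)
            - ((Real.pi * Real.cot (Real.pi * ν / 2) : ℝ) : ℂ) *
                ((ω : ℂ) ^ m * g ω / ((|ω| ^ ν : ℝ) : ℂ))) := by
  refine ⟨c, fun k => c (k + m), fun k hk => ?_, fun k => ?_, fun ω hω hωa hωρ => ?_⟩
  · exact H.hasConvergentIntegral hν (fun j hj => H.coeff_eq_zero ha hg hfg (hj.trans_lt hk))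
      fun x hx0 hx => momentIntegrand_of_pow_mul hfg k hx0 hx
  · refine H.hasFinitePart hν fun x hx0 hx => ?_
    rw [momentIntegrand_of_pow_mul hfg (k + m) hx0 hx, add_assoc k, pow_add _ k,
      (Even.add_self m).neg_one_pow, mul_one]
    push_cast
    rw [add_sub_cancel_right]
  · obtain ⟨hs, hpv⟩ := H.hasPV ω hω hωa hωρ
    refine ⟨(summable_nat_add_iff m).2 hs, ?_⟩
    rw [← hs.sum_add_tsum_nat_add m, hfg ω hωa.le] at hpv
    convert hpv using 1
    ring

theorem of_pow_mul_even (H : IsMomentExpansion ν a f α c) (hν : ν ∈ Ioo (0 : ℝ) 1) (ha : 0 < a)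
    {m : ℕ} {g : ℝ → ℂ} (hg : ComplexAnalyticIn g (symmInterval a))
    (hfg : ∀ x ∈ symmInterval a, f x = (x : ℂ) ^ m * g x)
    (heven : ∀ x ∈ symmInterval a, g (-x) = g x) :
    ∃ d c : ℕ → ℂ,
      (∀ k < m / 2, HasConvergentIntegral
        (fun x : ℝ => g x /
          ((x ^ (2 * (k : ℝ) - 2 * ((m / 2 : ℕ) : ℝ) + ν + 1) : ℝ) : ℂ)) a (d k)) ∧
      (∀ k : ℕ, HasFinitePart
        (fun x : ℝ => g x / ((x ^ (2 * (k : ℝ) + ν + 1) : ℝ) : ℂ)) a (c k)) ∧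
      ∀ ω : ℝ, ω ≠ 0 → ‖ω‖ₑ < a → ‖ω‖ₑ < singularityDistance f →
        Summable (fun k : ℕ => (ω : ℂ) ^ (2 * k + m) * c k) ∧
        HasPV (hilbertIntegrand ν f ω) ω a
          (-2 * (∑' k : ℕ, (ω : ℂ) ^ (2 * k + m) * c k)
            - ((Real.pi * Real.cot (Real.pi * ν / 2) : ℝ) : ℂ) *
                ((ω : ℂ) ^ m * g ω / ((|ω| ^ ν : ℝ) : ℂ))
            - 2 * (∑ k ∈ Finset.range (m / 2),
                (ω : ℂ) ^ (2 * k + (2 * ((m + 1) / 2) - m)) * d k)) := by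
  have hpar : ∀ x ∈ symmInterval a, f (-x) = (-1) ^ m * f x := fun x hx => by
    rw [hfg x hx, hfg (-x) (neg_mem_symmInterval hx), heven x hx]
    push_cast
    rw [neg_pow (x : ℂ), mul_assoc]
  -- Only moments of order `2 k + e` survive, `e` being the parity of `m`. The first `s` of them are
  -- convergent integrals. The natural subtraction `2 * ((m + 1) / 2) - m` does not truncate and
  -- equals `e`.
  obtain ⟨s, e, he, hm⟩ : ∃ s e : ℕ, (e = 0 ∨ e = 1) ∧ m = 2 * s + e :=
    ⟨m / 2, m % 2, Nat.mod_two_eq_zero_or_one m, (Nat.div_add_mod m 2).symm⟩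
  have hms : m / 2 = s := by omega
  have hexp : 2 * ((m + 1) / 2) - m = e := by omega
  rw [hms, hexp]
  have hint : ∀ (k : ℕ) (x : ℝ), 0 < x → x ∈ symmInterval a →
      1 / 2 * momentIntegrand ν f (2 * k + e) x =
        g x / ((x ^ (2 * (k : ℝ) - 2 * (s : ℝ) + ν + 1) : ℝ) : ℂ) := fun k x hx0 hx => by
    have hev : Even (2 * k + e + m) := ⟨k + s + e, by omega⟩
    have hxp : ((2 * k + e : ℕ) : ℝ) - m + ν + 1 = 2 * (k : ℝ) - 2 * (s : ℝ) + ν + 1 := by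
      rw [hm]
      push_cast
      ring
    rw [momentIntegrand_of_pow_mul hfg _ hx0 hx, hev.neg_one_pow, heven x hx, hxp]
    ring
  -- The factor `1 / 2` compensates for `g (-x) + g x = 2 g x`.
  refine ⟨fun k => 1 / 2 * c (2 * k + e), fun k => 1 / 2 * c (2 * k + m), fun k hk => ?_,
    fun k => ?_, fun ω hω hωa hωρ => ?_⟩
  · exact H.hasConvergentIntegral_mul hν
      (fun j hj => H.coeff_eq_zero ha hg hfg (by omega)) _ fun x hx0 hx => hint k x hx0 hx
  · refine H.hasFinitePart_mul hν _ fun x hx0 hx => ?_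
    have := hint (k + s) x hx0 hx
    rw [show 2 * (k + s) + e = 2 * k + m by omega] at this
    rw [this]
    congr 4
    push_cast
    ring
  · obtain ⟨hs, hpv⟩ := H.hasPV ω hω hωa hωρ
    have hse : Summable fun k : ℕ => (ω : ℂ) ^ (2 * k + e) * c (2 * k + e) :=
      hs.comp_injective (i := fun k : ℕ => 2 * k + e) fun i j hij => by
        simp only at hij
        omega
    have htsum : ∑' k : ℕ, (ω : ℂ) ^ k * c k =
        ∑' k : ℕ, (ω : ℂ) ^ (2 * k + e) * c (2 * k + e) := by
      refine (Function.Injective.tsum_eq (g := fun k : ℕ => 2 * k + e) (fun i j hij => by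
        simp only at hij
        omega) fun k hk => ?_).symm
      by_contra hk'
      refine hk ?_
      have hodd : Odd (k + m) := by
        rw [← Nat.not_even_iff_odd]
        rintro ⟨t, ht⟩
        rcases le_or_gt e k with h | h
        · exact hk' ⟨(k - e) / 2, by
            show 2 * ((k - e) / 2) + e = k
            omega⟩
        · omega
      simp only [H.moment_eq_zero ha hpar hodd, mul_zero]
    have hshift : ∀ k : ℕ, 2 * (k + s) + e = 2 * k + m := fun k => by omega
    have hse' := (summable_nat_add_iff s).2 hse
    have hsplit := hse.sum_add_tsum_nat_add s
    simp only [hshift] at hse' hsplit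
    refine ⟨(hse'.mul_left (1 / 2)).congr fun k => by ring, ?_⟩
    rw [htsum, ← hsplit, hfg ω hωa.le] at hpv
    convert hpv using 1
    rw [tsum_congr fun k : ℕ => (by ring : (ω : ℂ) ^ (2 * k + m) * (1 / 2 * c (2 * k + m)) =
      1 / 2 * ((ω : ℂ) ^ (2 * k + m) * c (2 * k + m))), tsum_mul_left,
      Finset.sum_congr rfl fun (k : ℕ) _ => (by ring : (ω : ℂ) ^ (2 * k + e) *
        (1 / 2 * c (2 * k + e)) = 1 / 2 * ((ω : ℂ) ^ (2 * k + e) * c (2 * k + e))),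
      ← Finset.mul_sum]
    ring

end IsMomentExpansion

end FinitePartHilbert

theorem theorem4p5 (ν : ℝ) (hν : ν ∈ Set.Ioo (0 : ℝ) 1) (a : ℝ≥0∞) (ha : 0 < a) (f : ℝ → ℂ)
    (hf : FinitePartHilbert.ComplexAnalyticIn f (FinitePartHilbert.symmInterval a))
    (hPV : a = ∞ → ∀ ω : ℝ, ω ≠ 0 → ‖ω‖ₑ < FinitePartHilbert.singularityDistance f →
      ∃ v : ℂ, FinitePartHilbert.HasPV (FinitePartHilbert.hilbertIntegrand ν f ω) ω a v) :
    -- the general formula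
    (∃ c : ℕ → ℂ,
      (∀ k : ℕ, FinitePartHilbert.HasFinitePart
        (fun x : ℝ => ((-1) ^ k * f (-x) + f x) / ((x ^ ((k : ℝ) + ν + 1) : ℝ) : ℂ)) a (c k)) ∧
      ∀ ω : ℝ, ω ≠ 0 → ‖ω‖ₑ < a → ‖ω‖ₑ < FinitePartHilbert.singularityDistance f →
        Summable (fun k : ℕ => (ω : ℂ) ^ k * c k) ∧
        FinitePartHilbert.HasPV (FinitePartHilbert.hilbertIntegrand ν f ω) ω a
          (-(∑' k : ℕ, (ω : ℂ) ^ k * c k)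
            - ((Real.pi * Real.cot (Real.pi * ν / 2) : ℝ) : ℂ) * (f ω / ((|ω| ^ ν : ℝ) : ℂ)))) ∧
    -- the case of even `f`
    ((∀ x ∈ FinitePartHilbert.symmInterval a, f (-x) = f x) →
      ∃ c : ℕ → ℂ,
        (∀ k : ℕ, FinitePartHilbert.HasFinitePart
          (fun x : ℝ => f x / ((x ^ (2 * (k : ℝ) + ν + 1) : ℝ) : ℂ)) a (c k)) ∧
        ∀ ω : ℝ, ω ≠ 0 → ‖ω‖ₑ < a → ‖ω‖ₑ < FinitePartHilbert.singularityDistance f →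
          Summable (fun k : ℕ => (ω : ℂ) ^ (2 * k) * c k) ∧
          FinitePartHilbert.HasPV (FinitePartHilbert.hilbertIntegrand ν f ω) ω a
            (-2 * (∑' k : ℕ, (ω : ℂ) ^ (2 * k) * c k)
              - ((Real.pi * Real.cot (Real.pi * ν / 2) : ℝ) : ℂ) *
                  (f ω / ((|ω| ^ ν : ℝ) : ℂ)))) ∧
    -- the case `f(x) = x ^ m * g(x)`
    (∀ (m : ℕ) (g : ℝ → ℂ),
      FinitePartHilbert.ComplexAnalyticIn g (FinitePartHilbert.symmInterval a) →
      (∀ x ∈ FinitePartHilbert.symmInterval a, f x = (x : ℂ) ^ m * g x) →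
      (∃ d c : ℕ → ℂ,
        (∀ k < m, FinitePartHilbert.HasConvergentIntegral
          (fun x : ℝ => ((-1) ^ (k + m) * g (-x) + g x) /
            ((x ^ ((k : ℝ) - m + ν + 1) : ℝ) : ℂ)) a (d k)) ∧
        (∀ k : ℕ, FinitePartHilbert.HasFinitePart
          (fun x : ℝ => ((-1) ^ k * g (-x) + g x) / ((x ^ ((k : ℝ) + ν + 1) : ℝ) : ℂ))
          a (c k)) ∧
        ∀ ω : ℝ, ω ≠ 0 → ‖ω‖ₑ < a → ‖ω‖ₑ < FinitePartHilbert.singularityDistance f →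
          Summable (fun k : ℕ => (ω : ℂ) ^ (k + m) * c k) ∧
          FinitePartHilbert.HasPV (FinitePartHilbert.hilbertIntegrand ν f ω) ω a
            (-(∑ k ∈ Finset.range m, (ω : ℂ) ^ k * d k)
              - (∑' k : ℕ, (ω : ℂ) ^ (k + m) * c k)
              - ((Real.pi * Real.cot (Real.pi * ν / 2) : ℝ) : ℂ) *
                  ((ω : ℂ) ^ m * g ω / ((|ω| ^ ν : ℝ) : ℂ)))) ∧
      -- the subcase of even `g`; here `m / 2` and `(m + 1) / 2` are integer parts
      ((∀ x ∈ FinitePartHilbert.symmInterval a, g (-x) = g x) →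
        ∃ d c : ℕ → ℂ,
          (∀ k < m / 2, FinitePartHilbert.HasConvergentIntegral
            (fun x : ℝ => g x /
              ((x ^ (2 * (k : ℝ) - 2 * ((m / 2 : ℕ) : ℝ) + ν + 1) : ℝ) : ℂ)) a (d k)) ∧
          (∀ k : ℕ, FinitePartHilbert.HasFinitePart
            (fun x : ℝ => g x / ((x ^ (2 * (k : ℝ) + ν + 1) : ℝ) : ℂ)) a (c k)) ∧
          ∀ ω : ℝ, ω ≠ 0 → ‖ω‖ₑ < a → ‖ω‖ₑ < FinitePartHilbert.singularityDistance f →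
            Summable (fun k : ℕ => (ω : ℂ) ^ (2 * k + m) * c k) ∧
            FinitePartHilbert.HasPV (FinitePartHilbert.hilbertIntegrand ν f ω) ω a
              (-2 * (∑' k : ℕ, (ω : ℂ) ^ (2 * k + m) * c k)
                - ((Real.pi * Real.cot (Real.pi * ν / 2) : ℝ) : ℂ) *
                    ((ω : ℂ) ^ m * g ω / ((|ω| ^ ν : ℝ) : ℂ))
                - 2 * (∑ k ∈ Finset.range (m / 2),
                    (ω : ℂ) ^ (2 * k + (2 * ((m + 1) / 2) - m)) * d k)))) := by
  obtain ⟨α, c, H⟩ := FinitePartHilbert.exists_isMomentExpansion hν ha hf hPV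
  refine ⟨⟨c, fun k => H.hasFinitePart hν fun x _ _ => rfl, H.hasPV⟩, fun heven => ?_,
    fun m g hg hfg => ⟨H.of_pow_mul hν ha hg hfg, H.of_pow_mul_even hν ha hg hfg⟩⟩
  -- Even `f` is the even case with `m = 0` and `g = f`, where the finite sum is empty.
  obtain ⟨_, c', _, hc', h'⟩ :=
    H.of_pow_mul_even (m := 0) hν ha hf (fun x _ => by rw [pow_zero, one_mul]) heven
  refine ⟨c', hc', fun ω hω hωa hωρ => ?_⟩
  simpa using h' ω hω hωa hωρ
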